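/- Let $\mathcal M$ be a finite non-empty set of integers $m\ge 2$ with largest element $M$, and let $c>0$. Put $$\beta_0 = 16+32M(1+e^2)+1792(1+e^{-2})M^2 .$$ There are numbers $\beta_1>M$ with $$\frac{\beta_1}{M}\log\frac{\beta_1}{M}-\frac{\beta_1}{M}+1>\frac{11}{c};$$ fix any such $\beta_1$ and set $\beta=\beta_0\sqrt{\beta_1}+M$ and $C=10M^2+2\beta$, a constant that depends only on $M$, $c$ and the choice of $\beta_1$. Let $n\ge 1$. For each $m\in\mathcal M$ let $\mathcal Q^{(m)}=(\mathcal Q^{(m)}_{i_1,\dots,i_m})_{i_1,\dots,i_m\in[n]}$ be a tensor with entries in $[0,1]$, and let $H_m=([n],E_m)$ be a random $m$-uniform hypergraph in which each $m$-subset $e=\{i_1,\dots,i_m\}$ of $[n]$ is a hyperedge with probability $\mathbb P(\mathcal A^{(m)}_e=1)=\mathcal Q^{(m)}_{i_1,\dots,i_m}$, where $\mathcal A^{(m)}_e=\mathbb 1\{e\in E_m\}$; the events $\{e\in E_m\}$, over all $m\in\mathcal M$ and all $m$-subsets $e$ of $[n]$, are mutually independent. Let $H=\bigcup_{m\in\mathcal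 M}H_m$ be the resulting inhomogeneous non-uniform Erdős–Rényi hypergraph. Define $d^{(m)}_{i_1,\dots,i_m}=\binom{n-1}{m-1}\mathcal Q^{(m)}_{i_1,\dots,i_m}$ and $$d_{\max}=\sum_{m\in\mathcal M}d^{(m)}_{\max},\qquad d^{(m)}_{\max}=\max_{i_1,\dots,i_m\in[n]}d^{(m)}_{i_1,\dots,i_m}.$$ Let $A$ be the adjacency matrix of $H$: $A_{ii}=0$, and for $i\ne j$ $$A_{ij}=\sum_{m\in\mathcal M}\ \sum_{e\subset[n],\,|e|=m,\,e\supset\{i,j\}}\mathcal A^{(m)}_e .$$ If $d_{\max}\ge c\log n$, then with probability at least $1-2n^{-10}-2e^{-n}$, $$\|A-\mathbb E A\|\le C\sqrt{d_{\max}},$$ where $\|\cdot\|$ is the spectral (Euclidean operator) norm. -/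

import Mathlib

open MeasureTheory ProbabilityTheory

noncomputable section

namespace RandomHypergraph

/-- An `m`-uniform hypergraph with vertex set the whole type `V`: every hyperedge is an
`m`-element subset of `V`. -/
structure UniformHypergraph (V : Type*) (m : ℕ) extends Hypergraph V where
  vertexSet_eq : vertexSet = Set.univ
  ncard_eq : ∀ e ∈ edgeSet, e.ncard = m

/-- Real tensors of order `m` and dimension `n`. -/
abbrev Tensor (n m : ℕ) : Type := (Fin m → Fin n) → ℝ

open scoped Classical in
/-- The indicator `𝒜_e` of the presence of `e` as a hyperedge of `H`. -/
def UniformHypergraph.edgeIndicator {V : Type*} {m : ℕ} (H : UniformHypergraph V m)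
    (e : Finset V) : ℝ :=
  if (e : Set V) ∈ H.edgeSet then 1 else 0

/-- The adjacency tensor: `𝒜 i₁ … iₘ = 1` if `{i₁, …, iₘ}` is a hyperedge, and `0` otherwise
(in particular `0` when two of the indices coincide). -/
def UniformHypergraph.adjacencyTensor {n m : ℕ} (H : UniformHypergraph (Fin n) m) : Tensor n m :=
  fun i => H.edgeIndicator (Finset.univ.image i)

/-- The adjacency matrix of the non-uniform hypergraph `⋃_{m ∈ 𝓜} H m`:
`A i j` is `0` if `i = j`, and otherwise the number of hyperedges containing both `i` and `j`. -/
def adjacencyMatrix {n : ℕ} (𝓜 : Finset ℕ) (H : (m : ℕ) → UniformHypergraph (Fin n) m) :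
    Matrix (Fin n) (Fin n) ℝ :=
  Matrix.of fun i j =>
    if i ≠ j then
      ∑ m ∈ 𝓜, ∑ e ∈ (Finset.univ.powersetCard m).filter (fun e => {i, j} ⊆ e),
        (H m).edgeIndicator e
    else 0

/-- The random hypergraph `ω ↦ ⋃_{m ∈ 𝓜} H m ω` on the vertex set `[n]`, defined on a probability
space `(Ω, μ)`, is an inhomogeneous non-uniform Erdős–Rényi hypergraph with probability tensors
`Q m`, `m ∈ 𝓜`: the hyperedge `{i₁, …, iₘ}` is present with probability `Q m (i₁, …, iₘ)`, and
the presences of all possible hyperedges (of all sizes `m ∈ 𝓜`) are mutually independent. -/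
structure IsErdosRenyi {n : ℕ} {Ω : Type*} [MeasurableSpace Ω] (μ : Measure Ω) (𝓜 : Finset ℕ)
    (Q : (m : ℕ) → Tensor n m) (H : (m : ℕ) → Ω → UniformHypergraph (Fin n) m) : Prop where
  /-- each `Q m` is a tensor of probabilities -/
  mem_Icc : ∀ m ∈ 𝓜, ∀ i : Fin m → Fin n, Q m i ∈ Set.Icc (0 : ℝ) 1
  /-- the presence of a possible hyperedge is an event -/
  measurableSet : ∀ m ∈ 𝓜, ∀ e : Finset (Fin n), MeasurableSet {ω | (e : Set (Fin n)) ∈ (H m ω).edgeSet}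
  /-- `ℙ(𝒜_{i₁, …, iₘ} = 1) = Q_{i₁, …, iₘ}` for distinct `i₁, …, iₘ` -/
  prob_eq : ∀ m ∈ 𝓜, ∀ i : Fin m → Fin n, Function.Injective i →
    μ.real {ω | (H m ω).adjacencyTensor i = 1} = Q m i
  /-- mutual independence over all pairs `(m, e)` with `m ∈ 𝓜` and `e` an `m`-subset of `[n]` -/
  indep : iIndepSet
    (fun p : (m : {m : ℕ // m ∈ 𝓜}) × {e : Finset (Fin n) // e.card = m.1} =>
      {ω | (p.2.1 : Set (Fin n)) ∈ (H p.1.1 ω).edgeSet}) μ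

/-- The rescaled tensor `d`, given by `Q_{i₁, …, iₘ} = (n-1 choose m-1)⁻¹ d_{i₁, …, iₘ}`. It is
written with a product, so that it is `0` for `m > n`, where there are no hyperedges. -/
def degreeTensor {n m : ℕ} (Q : Tensor n m) : Tensor n m :=
  fun i => ((n - 1).choose (m - 1) : ℝ) * Q i

/-- `d_max = ∑_{m ∈ 𝓜} max_{i₁, …, iₘ ∈ [n]} d_{i₁, …, iₘ}`. -/
def dMax {n : ℕ} (𝓜 : Finset ℕ) (Q : (m : ℕ) → Tensor n m) : ℝ :=
  ∑ m ∈ 𝓜, ⨆ i : Fin m → Fin n, degreeTensor (Q m) i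

/-- The entrywise expectation of a random matrix. -/
def expectedMatrix {n : ℕ} {Ω : Type*} [MeasurableSpace Ω] (μ : Measure Ω)
    (A : Ω → Matrix (Fin n) (Fin n) ℝ) : Matrix (Fin n) (Fin n) ℝ :=
  Matrix.of fun i j => ∫ ω, A ω i j ∂μ

/-- The norm of a real square matrix as an operator on Euclidean space. -/
def opNorm {n : ℕ} (W : Matrix (Fin n) (Fin n) ℝ) : ℝ :=
  ‖Matrix.toEuclideanCLM (n := Fin n) (𝕜 := ℝ) W‖

/-- `β₀ = 16 + 32 M (1 + e²) + 1792 (1 + e⁻²) M²`. -/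
def beta0 (M : ℕ) : ℝ :=
  16 + 32 * M * (1 + Real.exp 2) + 1792 * (1 + Real.exp (-2)) * (M : ℝ) ^ 2

/-- `β₁` is large enough: `β₁ > M` and
`(β₁ / M) log (β₁ / M) - β₁ / M + 1 > 11 / c`. -/
def IsLargeEnough (M : ℕ) (c β₁ : ℝ) : Prop :=
  (M : ℝ) < β₁ ∧ 11 / c < β₁ / M * Real.log (β₁ / M) - β₁ / M + 1

/-- `C = 10 M² + 2 β` with `β = β₀ √β₁ + M`. -/
def concentrationConst (M : ℕ) (β₁ : ℝ) : ℝ :=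
  10 * (M : ℝ) ^ 2 + 2 * (beta0 M * Real.sqrt β₁ + M)

end RandomHypergraph

end

/-!
The proof is the Kahn–Szemerédi argument. The adjacency matrix is `A = ∑ p, 1_{E p} (adjacency of
the hyperedge e p)`, summed over the possible hyperedges `p`, with independent events `E p`. Since
`A - 𝔼 A` is symmetric, its norm is at most twice the supremum of its quadratic form over a
`1/4`-net of the unit ball (`norm_le_two_mul_of_net`), and the volume bound provides a net with at
most `9 ^ n` points (`exists_quarter_net`).

For a fixed `x` the pairs `(i, j)` are split according to whether `|x i * x j| ≤ √d / n`
(`quadForm_le`), where `d = d_max`.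

* The light pairs contribute a centred weighted sum of independent indicators, with weights at most
  `M² √d / n` and variance at most `M³ d / n`. Bernstein's inequality bounds it by `5 M² √d` up to
  probability `2 exp (-9 n / 2)`, which survives the union bound over the net (`light_le`).
* The heavy pairs of `𝔼 A` contribute at most `M √d`, because `𝔼 A i j ≤ M d / n`.
* The heavy pairs of `A` contribute at most `β₀ √β₁ √d` for all `x` at once (`heavy_sum_le`), as soon
  as `A` has row sums at most `β₁ d` and the discrepancy property: the weight `w` between two vertex
  sets `S` and `T` with `|S| ≤ |T|` is at most `e²` times `ν = M d |S| |T| / n`, or satisfies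
  `w log (w / ν) ≤ 28 M² |T| log (e n / |T|)`. By Chernoff's inequality and union bounds over
  vertices and over pairs of sets, each of the two fails with probability at most `n⁻¹⁰`
  (`degree_le`, `discrepancy_le`).

The deterministic estimate for heavy pairs groups the coordinates of `x` into dyadic levels; for two
levels it is a case distinction on the density of `A` between them (`heavy_pair_le`), and in each
case the sum over the levels is a geometric series (`heavy_levels_le`).
-/

open MeasureTheory ProbabilityTheory

namespace RandomHypergraph

/-! ### Exponential tail bounds for weighted sums of independent indicators -/

section Chernoff

/-- The random sum `∑ p, b p * 1_{E p}`. -/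
noncomputable def weightedCount {Ω P : Type*} [Fintype P] (E : P → Set Ω) (b : P → ℝ) (ω : Ω) : ℝ :=
  ∑ p, b p * (E p).indicator 1 ω

theorem weightedCount_smul {Ω P : Type*} [Fintype P] {E : P → Set Ω} (c : ℝ) (b : P → ℝ) (ω : Ω) :
    weightedCount E (fun p => c * b p) ω = c * weightedCount E b ω := by
  simp only [weightedCount, Finset.mul_sum, mul_assoc]

/-- A weighted sum of finitely many indicators takes finitely many values. -/
theorem finite_range_weightedCount {Ω P : Type*} [Fintype P] (E : P → Set Ω) (b : P → ℝ) :
    (Set.range (weightedCount E b)).Finite := by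
  classical
  refine (Set.finite_range fun s : Finset P => ∑ p ∈ s, b p).subset ?_
  rintro _ ⟨ω, rfl⟩
  refine ⟨Finset.univ.filter fun p => ω ∈ E p, ?_⟩
  simp [weightedCount, Finset.sum_filter, Set.indicator_apply]

theorem integrable_indicator_one {Ω : Type*} [MeasurableSpace Ω] {μ : Measure Ω}
    [IsFiniteMeasure μ] {A : Set Ω} (hA : MeasurableSet A) :
    Integrable (A.indicator (1 : Ω → ℝ)) μ :=
  (integrable_const (1 : ℝ)).indicator (hA)

theorem mgf_mul_indicator {Ω : Type*} [MeasurableSpace Ω] {μ : Measure Ω} [IsProbabilityMeasure μ]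
    {A : Set Ω} (hA : MeasurableSet A) (b : ℝ) :
    mgf (fun ω => b * A.indicator 1 ω) μ 1 = 1 + μ.real A * (Real.exp b - 1) := by
  have h : ∀ ω, Real.exp (1 * (b * A.indicator (1 : Ω → ℝ) ω)) =
      1 + (Real.exp b - 1) * A.indicator (1 : Ω → ℝ) ω := by
    intro ω
    by_cases h : ω ∈ A <;> simp [h]
  simp only [mgf, h]
  rw [integral_add (integrable_const _) ((integrable_indicator_one hA).const_mul _),
    integral_const_mul, integral_indicator_one hA]
  simp [mul_comm]

variable {Ω P : Type*} [MeasurableSpace Ω] [Fintype P] {μ : Measure Ω} [IsProbabilityMeasure μ]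
  {E : P → Set Ω}

theorem measurable_weightedCount (hE : ∀ p, MeasurableSet (E p)) (b : P → ℝ) :
    Measurable (weightedCount E b) := by
  unfold weightedCount
  refine Finset.measurable_sum _ fun p _ => Measurable.const_mul ?_ _
  exact measurable_one.indicator (hE p)

theorem integral_weightedCount (hE : ∀ p, MeasurableSet (E p)) (b : P → ℝ) :
    ∫ ω, weightedCount E b ω ∂μ = ∑ p, b p * μ.real (E p) := by
  unfold weightedCount
  rw [integral_finsetSum]
  · refine Finset.sum_congr rfl fun p _ => ?_
    rw [integral_const_mul, integral_indicator_one (hE p)]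
  · intro p _
    exact (integrable_indicator_one (hE p)).const_mul _

theorem integrable_exp_weightedCount (hE : ∀ p, MeasurableSet (E p)) (b : P → ℝ) :
    Integrable (fun ω => Real.exp (weightedCount E b ω)) μ := by
  refine Integrable.of_bound
    (Real.measurable_exp.comp (measurable_weightedCount hE b)).aestronglyMeasurable
    (Real.exp (∑ p, |b p|)) (Filter.Eventually.of_forall fun ω => ?_)
  rw [Real.norm_eq_abs, abs_of_pos (Real.exp_pos _)]
  refine Real.exp_le_exp.2 (Finset.sum_le_sum fun p _ => ?_)
  by_cases h : ω ∈ E p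
  · simpa [h] using le_abs_self (b p)
  · simp [h]

/-- The exponential moment of a weighted sum of independent indicators is at most that of the
Poisson sum with the same means. -/
theorem mgf_weightedCount_le (hE : ∀ p, MeasurableSet (E p)) (hind : iIndepSet E μ) (b : P → ℝ) :
    mgf (weightedCount E b) μ 1 ≤ Real.exp (∑ p, μ.real (E p) * (Real.exp (b p) - 1)) := by
  have hfun : iIndepFun (fun p ω => b p * (E p).indicator (1 : Ω → ℝ) ω) μ :=
    hind.iIndepFun_indicator.comp (fun p x => b p * x) fun p => measurable_const_mul _
  have hsum : weightedCount E b = ∑ p, fun ω => b p * (E p).indicator (1 : Ω → ℝ) ω := by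
    ext ω; simp [weightedCount]
  rw [hsum, hfun.mgf_sum fun p => (measurable_one.indicator (hE p)).const_mul _, Real.exp_sum]
  refine Finset.prod_le_prod (fun p _ => mgf_nonneg) fun p _ => ?_
  rw [mgf_mul_indicator (hE p), add_comm]
  exact Real.add_one_le_exp _

theorem measure_weightedCount_ge_le (hE : ∀ p, MeasurableSet (E p)) (hind : iIndepSet E μ)
    (b : P → ℝ) (t : ℝ) :
    μ.real {ω | t ≤ weightedCount E b ω} ≤
      Real.exp (-t + ∑ p, μ.real (E p) * (Real.exp (b p) - 1)) := by
  have h := measure_ge_le_exp_mul_mgf (μ := μ) (X := weightedCount E b) t zero_le_one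
    (by simpa using integrable_exp_weightedCount hE b)
  rw [Real.exp_add]
  refine h.trans ?_
  rw [neg_one_mul]
  exact mul_le_mul_of_nonneg_left (mgf_weightedCount_le hE hind b) (Real.exp_pos _).le

/-- Chernoff's upper tail for a sum of independent indicators with weights in `[0, K]` and mean at
most `ν`. -/
theorem chernoff_upper (hE : ∀ p, MeasurableSet (E p)) (hind : iIndepSet E μ)
    {a : P → ℝ} {K ν k : ℝ} (hK : 0 < K) (ha : ∀ p, 0 ≤ a p) (haK : ∀ p, a p ≤ K)
    (hν : ∑ p, a p * μ.real (E p) ≤ ν) (hk : 1 ≤ k) :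
    μ.real {ω | k * ν ≤ weightedCount E a ω} ≤
      Real.exp (-(ν / K * (k * Real.log k - k + 1))) := by
  rcases hk.eq_or_lt with rfl | hk1
  · simp [measureReal_le_one]
  have hk0 : 0 < k := by linarith
  have hlog : 0 < Real.log k := Real.log_pos hk1
  set l := Real.log k / K with hl
  have hlpos : 0 < l := div_pos hlog hK
  have hset : {ω | k * ν ≤ weightedCount E a ω} =
      {ω | l * (k * ν) ≤ weightedCount E (fun p => l * a p) ω} := by
    ext ω
    simp only [Set.mem_ofPred_eq, weightedCount_smul]
    exact (mul_le_mul_iff_right₀ hlpos).symm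
  rw [hset]
  refine (measure_weightedCount_ge_le hE hind _ _).trans (Real.exp_le_exp.2 ?_)
  have key : ∀ p, Real.exp (l * a p) - 1 ≤ a p / K * (k - 1) := by
    intro p
    -- convexity of `exp` between `0` and `log k`
    have hx0 : 0 ≤ a p / K := div_nonneg (ha p) hK.le
    have hx1 : a p / K ≤ 1 := (div_le_one hK).2 (haK p)
    have := convexOn_exp.2 (Set.mem_univ (0 : ℝ)) (Set.mem_univ (Real.log k))
      (sub_nonneg.2 hx1) hx0 (by ring)
    simp only [smul_eq_mul, Real.exp_zero, Real.exp_log hk0, mul_zero, zero_add] at this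
    have e : l * a p = a p / K * Real.log k := by rw [hl]; ring
    rw [e]
    linarith
  have hsum : ∑ p, μ.real (E p) * (Real.exp (l * a p) - 1) ≤ ν / K * (k - 1) := by
    calc ∑ p, μ.real (E p) * (Real.exp (l * a p) - 1)
        ≤ ∑ p, μ.real (E p) * (a p / K * (k - 1)) :=
          Finset.sum_le_sum fun p _ => mul_le_mul_of_nonneg_left (key p) measureReal_nonneg
      _ = (∑ p, a p * μ.real (E p)) * ((k - 1) / K) := by
          rw [Finset.sum_mul]; exact Finset.sum_congr rfl fun p _ => by ring
      _ ≤ ν * ((k - 1) / K) :=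
          mul_le_mul_of_nonneg_right hν (div_nonneg (by linarith) hK.le)
      _ = _ := by ring
  have : l * (k * ν) = ν / K * (k * Real.log k) := by rw [hl]; ring
  rw [this]
  linarith

/-- Bernstein-type upper tail for a centred weighted sum of independent indicators. -/
theorem centered_upper (hE : ∀ p, MeasurableSet (E p)) (hind : iIndepSet E μ)
    {Y : P → ℝ} {l t σ : ℝ} (hl : 0 < l) (hY : ∀ p, |l * Y p| ≤ 1)
    (hσ : ∑ p, μ.real (E p) * Y p ^ 2 ≤ σ) :
    μ.real {ω | t ≤ weightedCount E Y ω - ∑ p, Y p * μ.real (E p)} ≤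
      Real.exp (-(l * t) + l ^ 2 * σ) := by
  set m := ∑ p, Y p * μ.real (E p) with hm
  have hset : {ω | t ≤ weightedCount E Y ω - m} =
      {ω | l * (t + m) ≤ weightedCount E (fun p => l * Y p) ω} := by
    ext ω
    simp only [Set.mem_ofPred_eq, weightedCount_smul, mul_le_mul_iff_right₀ hl]
    exact le_sub_iff_add_le
  rw [hset]
  refine (measure_weightedCount_ge_le hE hind _ _).trans (Real.exp_le_exp.2 ?_)
  have key : ∀ p, Real.exp (l * Y p) - 1 ≤ l * Y p + l ^ 2 * Y p ^ 2 := by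
    intro p
    have := (abs_le.1 (Real.abs_exp_sub_one_sub_id_le (hY p))).2
    nlinarith
  have hsum : ∑ p, μ.real (E p) * (Real.exp (l * Y p) - 1) ≤ l * m + l ^ 2 * σ := by
    calc ∑ p, μ.real (E p) * (Real.exp (l * Y p) - 1)
        ≤ ∑ p, μ.real (E p) * (l * Y p + l ^ 2 * Y p ^ 2) :=
          Finset.sum_le_sum fun p _ => mul_le_mul_of_nonneg_left (key p) measureReal_nonneg
      _ = l * m + l ^ 2 * ∑ p, μ.real (E p) * Y p ^ 2 := by
          rw [hm, Finset.mul_sum, Finset.mul_sum, ← Finset.sum_add_distrib]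
          exact Finset.sum_congr rfl fun p _ => by ring
      _ ≤ _ := by gcongr
  linarith

theorem centered_abs (hE : ∀ p, MeasurableSet (E p)) (hind : iIndepSet E μ)
    {Y : P → ℝ} {l t σ : ℝ} (hl : 0 < l) (hY : ∀ p, |l * Y p| ≤ 1)
    (hσ : ∑ p, μ.real (E p) * Y p ^ 2 ≤ σ) :
    μ.real {ω | t ≤ |weightedCount E Y ω - ∑ p, Y p * μ.real (E p)|} ≤
      2 * Real.exp (-(l * t) + l ^ 2 * σ) := by
  have h1 := centered_upper hE hind (t := t) hl hY hσ
  have h2 := centered_upper hE hind (Y := fun p => -Y p) (t := t) hl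
    (by simpa using hY) (by simpa using hσ)
  have hsub : {ω | t ≤ |weightedCount E Y ω - ∑ p, Y p * μ.real (E p)|} ⊆
      {ω | t ≤ weightedCount E Y ω - ∑ p, Y p * μ.real (E p)} ∪
      {ω | t ≤ weightedCount E (fun p => -Y p) ω - ∑ p, -Y p * μ.real (E p)} := by
    intro ω hω
    rcases le_abs.1 hω.out with h | h
    · exact Or.inl h
    · refine Or.inr (h.trans_eq ?_)
      simp [weightedCount]
      ring
  calc _ ≤ _ := measureReal_mono hsub
    _ ≤ _ := measureReal_union_le _ _
    _ ≤ _ := by linarith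

/-- Chernoff's bound in the form used for discrepancies: the deviation
`X log (X / ν)` of a weighted count `X > e² ν` is rarely larger than `2 K u`. -/
theorem chernoff_entropy (hE : ∀ p, MeasurableSet (E p)) (hind : iIndepSet E μ)
    {a : P → ℝ} {K ν : ℝ} (hK : 0 < K) (ha : ∀ p, 0 ≤ a p) (haK : ∀ p, a p ≤ K)
    (hν0 : 0 < ν) (hν : ∑ p, a p * μ.real (E p) ≤ ν) (u : ℝ) :
    μ.real {ω | Real.exp 2 * ν < weightedCount E a ω ∧
      2 * K * u < weightedCount E a ω * Real.log (weightedCount E a ω / ν)} ≤ Real.exp (-u) := by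
  set V := {ω | Real.exp 2 * ν < weightedCount E a ω ∧
      2 * K * u < weightedCount E a ω * Real.log (weightedCount E a ω / ν)} with hV
  rcases V.eq_empty_or_nonempty with h0 | hne
  · rw [h0]; simp [(Real.exp_pos _).le]
  -- the smallest value of the count on the event serves as the threshold
  obtain ⟨y, ⟨ω₀, hω₀, rfl⟩, hy⟩ := Set.exists_min_image (weightedCount E a '' V) id
    ((finite_range_weightedCount E a).subset (Set.image_subset_range _ _)) (hne.image _)
  set x := weightedCount E a ω₀ with hx
  obtain ⟨h1, h2⟩ := hω₀
  rw [← hx] at h1 h2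
  set k := x / ν with hkdef
  have hxk : k * ν = x := by rw [hkdef]; field_simp
  have hke : Real.exp 2 < k := by rw [hkdef, lt_div_iff₀ hν0]; exact h1
  have hk0 : 0 < k := (Real.exp_pos 2).trans hke
  have hlog : 2 < Real.log k := (Real.lt_log_iff_exp_lt hk0).2 hke
  have hk1 : 1 ≤ k := by
    have := Real.add_one_le_exp (2 : ℝ)
    linarith
  have hsub : V ⊆ {ω | k * ν ≤ weightedCount E a ω} := fun ω hω => by
    rw [Set.mem_ofPred_eq, hxk]
    exact hy _ ⟨ω, hω, rfl⟩
  refine (measureReal_mono hsub).trans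
    ((chernoff_upper hE hind hK ha haK hν hk1).trans (Real.exp_le_exp.2 ?_))
  have h3 : u < x * Real.log k / (2 * K) := by
    rw [lt_div_iff₀ (by positivity)]; linarith
  have h4 : x * Real.log k / (2 * K) ≤ ν / K * (k * Real.log k - k + 1) := by
    rw [← hxk, div_le_iff₀ (by positivity)]
    have : ν / K * (k * Real.log k - k + 1) * (2 * K) = ν * (2 * (k * Real.log k - k + 1)) := by
      field_simp
    rw [this]
    nlinarith [mul_pos hν0 hk0, mul_pos (mul_pos hν0 hk0) (sub_pos.2 hlog)]
  linarith

end Chernoff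

/-! ### Nets of the unit ball and the norm of a symmetric operator -/

section Net

open Module Metric

/-- Volume bound: a `1/4`-separated subset of the unit ball has at most `9 ^ dim` elements. -/
theorem card_le_of_quarter_separated {E : Type*} [NormedAddCommGroup E] [NormedSpace ℝ E]
    [FiniteDimensional ℝ E] (s : Finset E) (hs : ∀ c ∈ s, ‖c‖ ≤ 1)
    (h : ∀ c ∈ s, ∀ d ∈ s, c ≠ d → 1 / 4 ≤ ‖c - d‖) : s.card ≤ 9 ^ finrank ℝ E := by
  -- the balls of radius `1/8` around the points are disjoint subsets of the ball of radius `9/8`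
  borelize E
  let μ : Measure E := Measure.addHaar
  have hdisj : (s : Set E).PairwiseDisjoint fun c => ball c (1 / 8) := by
    intro c hc d hd hcd
    refine ball_disjoint_ball ?_
    rw [dist_eq_norm]
    linarith [h c hc d hd hcd]
  have hsub : (⋃ c ∈ s, ball c (1 / 8)) ⊆ ball (0 : E) (9 / 8) := by
    refine Set.iUnion₂_subset fun x hx => ball_subset_ball' ?_
    rw [dist_zero_right]
    linarith [hs x hx]
  have hvol := measure_mono (μ := μ) hsub
  rw [measure_biUnion_finset hdisj fun c _ => measurableSet_ball] at hvol
  simp only [μ.addHaar_ball_of_pos _ (show (0 : ℝ) < 1 / 8 by norm_num),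
    μ.addHaar_ball_of_pos _ (show (0 : ℝ) < 9 / 8 by norm_num), Finset.sum_const, nsmul_eq_mul,
    ← mul_assoc] at hvol
  have hvol' := (ENNReal.mul_le_mul_iff_left (measure_ball_pos _ _ zero_lt_one).ne'
    measure_ball_lt_top.ne).1 hvol
  have := ENNReal.toReal_le_of_le_ofReal (by positivity) hvol'
  rw [ENNReal.toReal_mul, ENNReal.toReal_natCast, ENNReal.toReal_ofReal (by positivity),
    show (9 / 8 : ℝ) = 9 * (1 / 8) by norm_num, mul_pow] at this
  exact_mod_cast le_of_mul_le_mul_right this (by positivity)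

theorem exists_quarter_net (E : Type*) [NormedAddCommGroup E] [NormedSpace ℝ E]
    [FiniteDimensional ℝ E] : ∃ s : Finset E, (∀ c ∈ s, ‖c‖ ≤ 1) ∧
      (∀ x : E, ‖x‖ ≤ 1 → ∃ c ∈ s, ‖x - c‖ ≤ 1 / 4) ∧ s.card ≤ 9 ^ finrank ℝ E := by
  classical
  by_contra! hcon
  -- without a net, separated sets extend forever
  have key : ∀ k : ℕ, ∃ s : Finset E, (∀ c ∈ s, ‖c‖ ≤ 1) ∧
      (∀ c ∈ s, ∀ d ∈ s, c ≠ d → 1 / 4 ≤ ‖c - d‖) ∧ s.card = k := by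
    intro k
    induction k with
    | zero => exact ⟨∅, by simp⟩
    | succ k ih =>
      obtain ⟨s, h1, h2, rfl⟩ := ih
      have hcard := card_le_of_quarter_separated s h1 h2
      obtain ⟨x, hx1, hx⟩ : ∃ x : E, ‖x‖ ≤ 1 ∧ ∀ c ∈ s, 1 / 4 < ‖x - c‖ := by
        by_contra! hno
        exact (hcon s h1 hno).not_ge hcard
      refine ⟨insert x s, ?_, ?_, ?_⟩
      · simpa using ⟨hx1, h1⟩
      · intro c hc d hd hcd
        rcases Finset.mem_insert.1 hc with rfl | hcs <;>
          rcases Finset.mem_insert.1 hd with rfl | hds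
        · exact absurd rfl hcd
        · exact (hx d hds).le
        · rw [norm_sub_rev]; exact (hx c hcs).le
        · exact h2 c hcs d hds hcd
      · refine Finset.card_insert_of_notMem fun hmem => ?_
        have := hx x hmem
        norm_num at this
  obtain ⟨s, h1, h2, h3⟩ := key (9 ^ finrank ℝ E + 1)
  have := card_le_of_quarter_separated s h1 h2
  omega

/-- The norm of a symmetric operator is at most twice the supremum of its quadratic form over a
`1/4`-net of the unit ball. -/
theorem norm_le_two_mul_of_net {E : Type*} [NormedAddCommGroup E] [InnerProductSpace ℝ E]
    {T : E →L[ℝ] E} (hT : (T : E →ₗ[ℝ] E).IsSymmetric) {s : Finset E} (hs : ∀ c ∈ s, ‖c‖ ≤ 1)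
    (hnet : ∀ x : E, ‖x‖ ≤ 1 → ∃ c ∈ s, ‖x - c‖ ≤ 1 / 4) {B : ℝ}
    (hB : ∀ c ∈ s, |inner ℝ (T c) c| ≤ B) : ‖T‖ ≤ 2 * B := by
  have hunit : ∀ x : E, ‖x‖ ≤ 1 → |inner ℝ (T x) x| ≤ B + ‖T‖ / 2 := by
    intro x hx
    obtain ⟨c, hc, hxc⟩ := hnet x hx
    have e : inner ℝ (T x) x = inner ℝ (T c) c + inner ℝ (T (x - c)) x + inner ℝ (T c) (x - c) := by
      simp only [map_sub, inner_sub_left, inner_sub_right]; ring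
    have b1 : |inner ℝ (T (x - c)) x| ≤ ‖T‖ * (1 / 4) := by
      refine (abs_real_inner_le_norm _ _).trans ?_
      calc ‖T (x - c)‖ * ‖x‖ ≤ (‖T‖ * (1 / 4)) * 1 := by
            gcongr
            exact (T.le_opNorm _).trans (by gcongr)
        _ = _ := mul_one _
    have b2 : |inner ℝ (T c) (x - c)| ≤ ‖T‖ * (1 / 4) := by
      refine (abs_real_inner_le_norm _ _).trans ?_
      calc ‖T c‖ * ‖x - c‖ ≤ (‖T‖ * 1) * (1 / 4) := by
            gcongr
            exact (T.le_opNorm _).trans (by gcongr; exact hs c hc)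
        _ = _ := by ring
    rw [e]
    have := abs_add_three (inner ℝ (T c) c) (inner ℝ (T (x - c)) x) (inner ℝ (T c) (x - c))
    linarith [hB c hc]
  have hB0 : 0 ≤ B + ‖T‖ / 2 := (abs_nonneg _).trans (hunit 0 (by simp))
  have : ‖T‖ ≤ B + ‖T‖ / 2 := by
    refine (T.norm_eq_iSup_rayleighQuotient hT).trans_le (Real.iSup_le (fun x => ?_) hB0)
    rcases eq_or_ne x 0 with rfl | hx
    · simpa [ContinuousLinearMap.rayleighQuotient] using hB0
    · have hx' : ‖x‖ ≠ 0 := norm_ne_zero_iff.2 hx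
      have h1 := hunit ((‖x‖)⁻¹ • x) (by rw [norm_smul, norm_inv, norm_norm, inv_mul_cancel₀ hx'])
      have e : T.rayleighQuotient x = inner ℝ (T ((‖x‖)⁻¹ • x)) ((‖x‖)⁻¹ • x) := by
        simp only [ContinuousLinearMap.rayleighQuotient, ContinuousLinearMap.reApplyInnerSelf,
          map_smul, real_inner_smul_left, real_inner_smul_right, RCLike.re_to_real]
        field_simp
      rw [e]; exact h1
  linarith

end Net

/-! ### Heavy pairs of two dyadic levels -/

section Heavy

theorem sum_two_zpow_le (F : Finset ℤ) (N : ℤ) (hF : ∀ i ∈ F, i ≤ N) :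
    ∑ i ∈ F, (2 : ℝ) ^ i ≤ 2 ^ (N + 1) := by
  induction F using Finset.induction_on_max generalizing N with
  | empty => simp; positivity
  | insert x s hs ih =>
    rw [Finset.sum_insert fun hx => lt_irrefl x (hs x hx)]
    have h1 := ih (x - 1) fun i hi => by have := hs i hi; omega
    have h2 : (2 : ℝ) ^ (x + 1) ≤ 2 ^ (N + 1) :=
      zpow_le_zpow_right₀ one_le_two (by have := hF x (Finset.mem_insert_self _ _); omega)
    rw [sub_add_cancel] at h1
    rw [zpow_add_one₀ two_ne_zero] at h2
    linarith

/-- A sum of distinct powers of `2`, each at most `B`, is at most `2 * B`. -/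
theorem sum_zpow_le_of_le (F : Finset ℤ) {B : ℝ} (hB : 0 ≤ B) :
    ∑ i ∈ F, (if (2 : ℝ) ^ i ≤ B then (2 : ℝ) ^ i else 0) ≤ 2 * B := by
  rw [← Finset.sum_filter]
  set G := F.filter fun i => (2 : ℝ) ^ i ≤ B
  rcases G.eq_empty_or_nonempty with h | h
  · rw [h]; simpa using hB
  · have hmem := G.max'_mem h
    have := sum_two_zpow_le G (G.max' h) fun i hi => G.le_max' i hi
    rw [zpow_add_one₀ two_ne_zero] at this
    have := (Finset.mem_filter.1 hmem).2
    linarith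

theorem sum_inv_zpow_le_of_le (F : Finset ℤ) {B : ℝ} (hB : 0 ≤ B) :
    ∑ i ∈ F, (if ((2 : ℝ) ^ i)⁻¹ ≤ B then ((2 : ℝ) ^ i)⁻¹ else 0) ≤ 2 * B := by
  have := sum_zpow_le_of_le (F.map (Equiv.neg ℤ).toEmbedding) hB
  simpa [Finset.sum_map, zpow_neg] using this

/-- The estimate for the pairs of coordinates in two dyadic levels. Here `a / √n` and `b / √n` are
the sizes of the coordinates, `s` and `t` (the larger one) the numbers of coordinates of these
sizes, `e` the total weight between them, `r = √d` and `w = √β₁`. With `k` the ratio of `e` to its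
typical value `ν` and `α' = t b² / n`, the five terms bound the contribution `e a b / n` when,
in order,
* `k ≤ exp 2` (or `k * r ≤ a * b`),
* `a` is so much larger than `b` that the row sums suffice,
* `log (exp 1 * n / t) ≤ 4 * log k`,
* `log k` is smaller than that, and `exp 1 / α' ≤ b ^ 2`, which forces `k < b`,
* `log k` is smaller than that, and `b ^ 2 < exp 1 / α'`, which forces `k * α' ≤ 4`.

Each indicator truncates a geometric series in one of the two levels. -/
theorem heavy_pair_le {e s t n a b r w M ξ : ℝ} (hs : 0 < s) (ht : 0 < t) (hn : 0 < n)
    (htn : t ≤ n) (ha : 0 < a) (hb : 0 < b) (hr : 0 < r) (hw : 0 < w) (hM : 0 < M) (hξ : 0 ≤ ξ)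
    (hab : r ≤ a * b) (he : 0 ≤ e) (hα : t * b ^ 2 / n ≤ 4)
    (hrow : e ≤ s * (w ^ 2 * r ^ 2))
    (hdisc : e ≤ Real.exp 2 * (M * r ^ 2 * s * t / n) ∨
      e * Real.log (e / (M * r ^ 2 * s * t / n)) ≤ ξ * (t * Real.log (Real.exp 1 * n / t))) :
    e * (a * b) / n ≤
      Real.exp 2 * M * r * (s * a ^ 2 / n) * (t * b ^ 2 / n) +
      w ^ 2 * r ^ 2 * (s * a ^ 2 / n) / a * (if b ≤ a / (w * r) then b else 0) +
      4 * ξ * (t * b ^ 2 / n) / b * (if a ≤ w * r * b then a else 0) +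
      2 * ξ / Real.exp 1 * (t * b ^ 2 / n) * (if a ≤ r then a else 0) +
      4 * M * r ^ 2 * (s * a ^ 2 / n) / a * (if b⁻¹ ≤ a / r then b⁻¹ else 0) := by
  have hαpos : 0 < s * a ^ 2 / n := by positivity
  have hα'pos : 0 < t * b ^ 2 / n := by positivity
  have n1 : 0 ≤ Real.exp 2 * M * r * (s * a ^ 2 / n) * (t * b ^ 2 / n) := by positivity
  have n2 : 0 ≤ w ^ 2 * r ^ 2 * (s * a ^ 2 / n) / a * (if b ≤ a / (w * r) then b else 0) := by
    refine mul_nonneg (by positivity) ?_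
    split_ifs <;> positivity
  have n3 : 0 ≤ 4 * ξ * (t * b ^ 2 / n) / b * (if a ≤ w * r * b then a else 0) := by
    refine mul_nonneg (by positivity) ?_
    split_ifs <;> positivity
  have n4 : 0 ≤ 2 * ξ / Real.exp 1 * (t * b ^ 2 / n) * (if a ≤ r then a else 0) := by
    refine mul_nonneg (by positivity) ?_
    split_ifs <;> positivity
  have n5 : 0 ≤ 4 * M * r ^ 2 * (s * a ^ 2 / n) / a * (if b⁻¹ ≤ a / r then b⁻¹ else 0) := by
    refine mul_nonneg (by positivity) ?_
    split_ifs <;> positivity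
  set ν := M * r ^ 2 * s * t / n with hν
  have hνpos : 0 < ν := by positivity
  have hνab : ν * (a * b) / n ≤ M * r * (s * a ^ 2 / n) * (t * b ^ 2 / n) := by
    have e1 : M * r * (s * a ^ 2 / n) * (t * b ^ 2 / n) =
        ν * (a * b) / n + M * r * s * t * (a * b) * (a * b - r) / n ^ 2 := by
      rw [hν]; field_simp; ring
    rw [e1]
    have : 0 ≤ M * r * s * t * (a * b) * (a * b - r) / n ^ 2 := by
      have := sub_nonneg.2 hab
      positivity
    linarith
  by_cases h1 : e ≤ Real.exp 2 * ν
  · have : e * (a * b) / n ≤ Real.exp 2 * (ν * (a * b) / n) := by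
      calc e * (a * b) / n ≤ Real.exp 2 * ν * (a * b) / n := by gcongr
        _ = _ := by ring
    have h2 := mul_le_mul_of_nonneg_left hνab (Real.exp_pos 2).le
    have h3 : Real.exp 2 * (M * r * (s * a ^ 2 / n) * (t * b ^ 2 / n)) =
      Real.exp 2 * M * r * (s * a ^ 2 / n) * (t * b ^ 2 / n) := by ring
    linarith
  have hdisc := hdisc.resolve_left h1
  rw [not_le] at h1
  set k := e / ν with hk
  have hek : e = k * ν := by rw [hk]; field_simp
  have hke : Real.exp 2 < k := by rw [hk, lt_div_iff₀ hνpos]; exact h1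
  have hk0 : 0 < k := (Real.exp_pos 2).trans hke
  have hlog : 2 < Real.log k := (Real.lt_log_iff_exp_lt hk0).2 hke
  have he0 : 0 < e := by rw [hek]; positivity
  by_cases h2 : b ≤ a / (w * r)
  · rw [if_pos h2] at n2 ⊢
    have : e * (a * b) / n ≤ w ^ 2 * r ^ 2 * (s * a ^ 2 / n) / a * b := by
      calc e * (a * b) / n ≤ s * (w ^ 2 * r ^ 2) * (a * b) / n := by gcongr
        _ = _ := by field_simp
    linarith
  have h2' : a ≤ w * r * b := by
    rw [not_le, div_lt_iff₀ (by positivity)] at h2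
    linarith
  set L := Real.log (Real.exp 1 * n / t) with hL
  have hnt : 1 ≤ n / t := (one_le_div ht).2 htn
  by_cases h3 : L ≤ 4 * Real.log k
  · rw [if_pos h2'] at n3 ⊢
    have h4 : e ≤ 4 * ξ * t := by
      have : e * Real.log k ≤ 4 * ξ * t * Real.log k := by
        calc _ ≤ ξ * (t * L) := hdisc
          _ ≤ ξ * (t * (4 * Real.log k)) := by gcongr
          _ = _ := by ring
      exact le_of_mul_le_mul_right this (by linarith)
    have : e * (a * b) / n ≤ 4 * ξ * (t * b ^ 2 / n) / b * a := by
      calc e * (a * b) / n ≤ 4 * ξ * t * (a * b) / n := by gcongr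
        _ = _ := by field_simp
    linarith
  rw [not_le] at h3
  -- now `k ^ 4 < exp 1 * n / t = exp 1 * b ^ 2 / α'`
  set α' := t * b ^ 2 / n with hα'
  have hnt' : Real.exp 1 * n / t = Real.exp 1 / α' * b ^ 2 := by rw [hα']; field_simp
  have hk4 : k ^ 4 < Real.exp 1 / α' * b ^ 2 := by
    have : Real.log (k ^ 4) < L := by rw [Real.log_pow]; exact_mod_cast h3
    rw [← hnt']
    exact (Real.log_lt_log_iff (by positivity) (by positivity)).1 this
  by_cases h5 : Real.exp 1 / α' ≤ b ^ 2
  · have hkb : k < b := by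
      have : k ^ 4 < b ^ 4 := by
        calc k ^ 4 < Real.exp 1 / α' * b ^ 2 := hk4
          _ ≤ b ^ 2 * b ^ 2 := by gcongr
          _ = b ^ 4 := by ring
      exact lt_of_pow_lt_pow_left₀ 4 hb.le this
    by_cases h6 : a ≤ r
    · rw [if_pos h6] at n4 ⊢
      have hlogb : Real.log b ≤ b / Real.exp 1 := by
        have := Real.log_le_sub_one_of_pos (show 0 < b / Real.exp 1 by positivity)
        rw [Real.log_div hb.ne' (Real.exp_pos 1).ne', Real.log_exp] at this
        linarith
      have hLb : L ≤ 4 * Real.log b := by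
        have : L ≤ Real.log (b ^ 4) := by
          refine Real.log_le_log (by positivity) ?_
          rw [hnt']
          calc _ ≤ b ^ 2 * b ^ 2 := by gcongr
            _ = b ^ 4 := by ring
        rwa [Real.log_pow] at this
      have h7 : 2 * e ≤ ξ * (t * (4 * (b / Real.exp 1))) := by
        calc 2 * e ≤ e * Real.log k := by
              rw [mul_comm]
              exact mul_le_mul_of_nonneg_left hlog.le he
          _ ≤ ξ * (t * L) := hdisc
          _ ≤ _ := by
            have := hLb.trans (mul_le_mul_of_nonneg_left hlogb (by norm_num : (0 : ℝ) ≤ 4))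
            gcongr
      have : e * (a * b) / n ≤ 2 * ξ / Real.exp 1 * α' * a := by
        calc e * (a * b) / n ≤ (ξ * (t * (2 * (b / Real.exp 1)))) * (a * b) / n := by
              gcongr
              linarith
          _ = _ := by rw [hα']; field_simp
      linarith
    · -- here `k * r ≤ a * b`, so the contribution is below the first term
      rw [not_le] at h6
      have : e * (a * b) / n ≤ M * r * (s * a ^ 2 / n) * α' := by
        have e1 : M * r * (s * a ^ 2 / n) * α' =
            e * (a * b) / n + M * r * s * t * (a * b) * (a * b - k * r) / n ^ 2 := by
          rw [hek, hα', hν]; field_simp; ring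
        rw [e1]
        have : 0 ≤ a * b - k * r := by
          have := mul_le_mul hkb.le h6.le hr.le hb.le
          linarith
        have : 0 ≤ M * r * s * t * (a * b) * (a * b - k * r) / n ^ 2 := by positivity
        linarith
      have h8 : M * r * (s * a ^ 2 / n) * α' ≤ Real.exp 2 * M * r * (s * a ^ 2 / n) * α' := by
        have : (1 : ℝ) ≤ Real.exp 2 := Real.one_le_exp (by norm_num)
        have h9 := mul_le_mul_of_nonneg_right this
          (show 0 ≤ M * r * (s * a ^ 2 / n) * α' by positivity)
        linarith
      linarith
  · rw [not_le] at h5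
    have h6 : b⁻¹ ≤ a / r := by
      rw [inv_le_iff_one_le_mul₀ hb, div_mul_eq_mul_div, one_le_div hr]
      exact hab
    rw [if_pos h6] at n5 ⊢
    have hk2 : k * α' ≤ 4 := by
      have h7 : k ^ 4 < (Real.exp 1 / α') ^ 2 := by
        calc k ^ 4 < Real.exp 1 / α' * b ^ 2 := hk4
          _ ≤ Real.exp 1 / α' * (Real.exp 1 / α') := by gcongr
          _ = _ := by ring
      have h8 : k ^ 2 < Real.exp 1 / α' := by
        refine lt_of_pow_lt_pow_left₀ 2 (by positivity) ?_
        calc (k ^ 2) ^ 2 = k ^ 4 := by ring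
          _ < _ := h7
      rw [lt_div_iff₀ hα'pos] at h8
      have he3 : Real.exp 1 < 4 := by
        have := Real.exp_one_lt_d9
        linarith
      refine le_of_sq_le_sq ?_ (by norm_num)
      calc (k * α') ^ 2 = (k ^ 2 * α') * α' := by ring
        _ ≤ 4 * 4 := by gcongr; linarith
        _ = 4 ^ 2 := by norm_num
    have : e * (a * b) / n ≤ 4 * M * r ^ 2 * (s * a ^ 2 / n) / a * b⁻¹ := by
      have e1 : e * (a * b) / n = (k * α') * (M * r ^ 2 * (s * a ^ 2 / n) / a * b⁻¹) := by
        rw [hek, hα', hν]; field_simp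
      have e2 : 4 * M * r ^ 2 * (s * a ^ 2 / n) / a * b⁻¹ =
          4 * (M * r ^ 2 * (s * a ^ 2 / n) / a * b⁻¹) := by ring
      rw [e1, e2]
      gcongr
    linarith

end Heavy

/-! ### Heavy pairs of a matrix with the discrepancy property -/

section Heavy

/-- Summation of `heavy_pair_le` over all pairs of dyadic levels `2 ^ i`, `2 ^ j`. The discrepancy
property concerns pairs with `s i ≤ s j`; symmetry of `e` costs a factor `2`. -/
theorem heavy_levels_le {F : Finset ℤ} {s : ℤ → ℝ} {n r w M ξ : ℝ} (hs : ∀ i ∈ F, 0 < s i)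
    (hn : 0 < n) (hsn : ∀ i ∈ F, s i ≤ n) (hr : 0 < r) (hw : 0 < w) (hM : 0 < M) (hξ : 0 ≤ ξ)
    (hsum : ∑ i ∈ F, s i * (2 ^ i) ^ 2 / n ≤ 4) {e : ℤ → ℤ → ℝ} (he : ∀ i j, 0 ≤ e i j)
    (hsymm : ∀ i j, e i j = e j i) (hrow : ∀ i j, e i j ≤ s i * (w ^ 2 * r ^ 2))
    (hdisc : ∀ i ∈ F, ∀ j ∈ F, s i ≤ s j → e i j ≤ Real.exp 2 * (M * r ^ 2 * s i * s j / n) ∨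
      e i j * Real.log (e i j / (M * r ^ 2 * s i * s j / n)) ≤
        ξ * (s j * Real.log (Real.exp 1 * n / s j))) :
    ∑ i ∈ F, ∑ j ∈ F, (if r ≤ 2 ^ i * 2 ^ j then e i j * (2 ^ i * 2 ^ j) / n else 0) ≤
      (16 * w + 32 * M * (Real.exp 2 + 2) + 64 * ξ * w + 32 * ξ / Real.exp 1) * r := by
  set α : ℤ → ℝ := fun i => s i * (2 ^ i) ^ 2 / n with hα
  have hα0 : ∀ i ∈ F, 0 ≤ α i := fun i hi => by have := hs i hi; simp only [hα]; positivity
  have hα4 : ∀ i ∈ F, α i ≤ 4 := fun i hi =>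
    (Finset.single_le_sum (f := α) hα0 hi).trans hsum
  set τ : ℤ → ℤ → ℝ := fun i j => if r ≤ 2 ^ i * 2 ^ j then e i j * (2 ^ i * 2 ^ j) / n else 0
    with hτ
  have hτsymm : ∀ i j, τ i j = τ j i := fun i j => by
    simp only [hτ, hsymm i j, mul_comm ((2 : ℝ) ^ i) (2 ^ j)]
  set G1 : ℤ → ℤ → ℝ := fun i j => Real.exp 2 * M * r * α i * α j with hG1
  set G2 : ℤ → ℤ → ℝ := fun i j => w ^ 2 * r ^ 2 * α i / 2 ^ i *
    (if (2 : ℝ) ^ j ≤ 2 ^ i / (w * r) then 2 ^ j else 0) with hG2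
  set G3 : ℤ → ℤ → ℝ := fun i j => 4 * ξ * α j / 2 ^ j *
    (if (2 : ℝ) ^ i ≤ w * r * 2 ^ j then 2 ^ i else 0) with hG3
  set G4 : ℤ → ℤ → ℝ := fun i j => 2 * ξ / Real.exp 1 * α j *
    (if (2 : ℝ) ^ i ≤ r then 2 ^ i else 0) with hG4
  set G5 : ℤ → ℤ → ℝ := fun i j => 4 * M * r ^ 2 * α i / 2 ^ i *
    (if ((2 : ℝ) ^ j)⁻¹ ≤ 2 ^ i / r then (2 ^ j)⁻¹ else 0) with hG5
  set G : ℤ → ℤ → ℝ := fun i j => G1 i j + G2 i j + G3 i j + G4 i j + G5 i j with hG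
  have hG0 : ∀ i ∈ F, ∀ j ∈ F, 0 ≤ G i j := by
    intro i hi j hj
    have h1 := hα0 i hi
    have h2 := hα0 j hj
    have p1 : 0 ≤ G1 i j := by simp only [hG1]; positivity
    have p2 : 0 ≤ G2 i j := mul_nonneg (by positivity) (by split_ifs <;> positivity)
    have p3 : 0 ≤ G3 i j := mul_nonneg (by positivity) (by split_ifs <;> positivity)
    have p4 : 0 ≤ G4 i j := mul_nonneg (by positivity) (by split_ifs <;> positivity)
    have p5 : 0 ≤ G5 i j := mul_nonneg (by positivity) (by split_ifs <;> positivity)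
    simp only [hG]
    linarith
  have hle : ∀ i ∈ F, ∀ j ∈ F, s i ≤ s j → τ i j ≤ G i j := by
    intro i hi j hj hij
    by_cases hab : r ≤ (2 : ℝ) ^ i * 2 ^ j
    · simp only [hτ, if_pos hab]
      exact heavy_pair_le (hs i hi) (hs j hj) hn (hsn j hj) (by positivity) (by positivity) hr hw
        hM hξ hab (he i j) (hα4 j hj) (hrow i j) (hdisc i hi j hj hij)
    · simp only [hτ, if_neg hab]
      exact hG0 i hi j hj
  have hle2 : ∀ i ∈ F, ∀ j ∈ F, τ i j ≤ G i j + G j i := by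
    intro i hi j hj
    rcases le_total (s i) (s j) with h | h
    · linarith [hle i hi j hj h, hG0 j hj i hi]
    · rw [hτsymm]
      linarith [hle j hj i hi h, hG0 i hi j hj]
  have hαsum0 : 0 ≤ ∑ i ∈ F, α i := Finset.sum_nonneg hα0
  have s1 : ∑ i ∈ F, ∑ j ∈ F, G1 i j ≤ 16 * Real.exp 2 * M * r := by
    have : ∑ i ∈ F, ∑ j ∈ F, G1 i j = Real.exp 2 * M * r * ((∑ i ∈ F, α i) * ∑ j ∈ F, α j) := by
      rw [Finset.sum_mul_sum]
      simp only [hG1, Finset.mul_sum, mul_assoc]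
    rw [this]
    calc _ ≤ Real.exp 2 * M * r * (4 * 4) := by gcongr
      _ = _ := by ring
  have s2 : ∑ i ∈ F, ∑ j ∈ F, G2 i j ≤ 8 * w * r := by
    calc ∑ i ∈ F, ∑ j ∈ F, G2 i j ≤ ∑ i ∈ F, 2 * w * r * α i := by
          refine Finset.sum_le_sum fun i hi => ?_
          simp only [hG2]
          rw [← Finset.mul_sum]
          have h1 := hα0 i hi
          calc _ ≤ w ^ 2 * r ^ 2 * α i / 2 ^ i * (2 * (2 ^ i / (w * r))) := by
                gcongr
                exact sum_zpow_le_of_le F (by positivity)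
            _ = _ := by field_simp
      _ = 2 * w * r * ∑ i ∈ F, α i := by rw [Finset.mul_sum]
      _ ≤ 2 * w * r * 4 := by gcongr
      _ = _ := by ring
  have s3 : ∑ i ∈ F, ∑ j ∈ F, G3 i j ≤ 32 * ξ * w * r := by
    rw [Finset.sum_comm]
    calc ∑ j ∈ F, ∑ i ∈ F, G3 i j ≤ ∑ j ∈ F, 8 * ξ * w * r * α j := by
          refine Finset.sum_le_sum fun j hj => ?_
          simp only [hG3]
          rw [← Finset.mul_sum]
          have h1 := hα0 j hj
          calc _ ≤ 4 * ξ * α j / 2 ^ j * (2 * (w * r * 2 ^ j)) := by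
                gcongr
                exact sum_zpow_le_of_le F (by positivity)
            _ = _ := by field_simp; ring
      _ = 8 * ξ * w * r * ∑ i ∈ F, α i := by rw [Finset.mul_sum]
      _ ≤ 8 * ξ * w * r * 4 := by gcongr
      _ = _ := by ring
  have s4 : ∑ i ∈ F, ∑ j ∈ F, G4 i j ≤ 16 * ξ / Real.exp 1 * r := by
    rw [Finset.sum_comm]
    calc ∑ j ∈ F, ∑ i ∈ F, G4 i j ≤ ∑ j ∈ F, 4 * ξ / Real.exp 1 * r * α j := by
          refine Finset.sum_le_sum fun j hj => ?_
          simp only [hG4]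
          rw [← Finset.mul_sum]
          have h1 := hα0 j hj
          calc _ ≤ 2 * ξ / Real.exp 1 * α j * (2 * r) := by
                gcongr
                exact sum_zpow_le_of_le F hr.le
            _ = _ := by ring
      _ = 4 * ξ / Real.exp 1 * r * ∑ i ∈ F, α i := by rw [Finset.mul_sum]
      _ ≤ 4 * ξ / Real.exp 1 * r * 4 := by gcongr
      _ = _ := by ring
  have s5 : ∑ i ∈ F, ∑ j ∈ F, G5 i j ≤ 32 * M * r := by
    calc ∑ i ∈ F, ∑ j ∈ F, G5 i j ≤ ∑ i ∈ F, 8 * M * r * α i := by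
          refine Finset.sum_le_sum fun i hi => ?_
          simp only [hG5]
          rw [← Finset.mul_sum]
          have h1 := hα0 i hi
          calc _ ≤ 4 * M * r ^ 2 * α i / 2 ^ i * (2 * (2 ^ i / r)) := by
                gcongr
                exact sum_inv_zpow_le_of_le F (by positivity)
            _ = _ := by field_simp; ring
      _ = 8 * M * r * ∑ i ∈ F, α i := by rw [Finset.mul_sum]
      _ ≤ 8 * M * r * 4 := by gcongr
      _ = _ := by ring
  have hGsum : ∑ i ∈ F, ∑ j ∈ F, G i j ≤ 16 * Real.exp 2 * M * r + 8 * w * r + 32 * ξ * w * r +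
      16 * ξ / Real.exp 1 * r + 32 * M * r := by
    simp only [hG, Finset.sum_add_distrib]
    linarith
  calc ∑ i ∈ F, ∑ j ∈ F, τ i j ≤ ∑ i ∈ F, ∑ j ∈ F, (G i j + G j i) :=
        Finset.sum_le_sum fun i hi => Finset.sum_le_sum fun j hj => hle2 i hi j hj
    _ = 2 * ∑ i ∈ F, ∑ j ∈ F, G i j := by
        simp only [Finset.sum_add_distrib]
        rw [Finset.sum_comm (f := fun i j => G j i)]
        ring
    _ ≤ 2 * (16 * Real.exp 2 * M * r + 8 * w * r + 32 * ξ * w * r +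
      16 * ξ / Real.exp 1 * r + 32 * M * r) := by gcongr
    _ = _ := by ring

/-- The discrepancy property of a nonnegative matrix: the weight between two sets of rows and
columns `S` and `T` is either comparable to `δ |S| |T| / n`, or bounded in terms of the entropy of
the larger set. -/
def HasDiscrepancy {V : Type*} [Fintype V] (A : V → V → ℝ) (δ ξ : ℝ) : Prop :=
  ∀ S T : Finset V, S.Nonempty → S.card ≤ T.card →
    ∑ i ∈ S, ∑ j ∈ T, A i j ≤ Real.exp 2 * (δ * S.card * T.card / Fintype.card V) ∨
    (∑ i ∈ S, ∑ j ∈ T, A i j) *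
        Real.log ((∑ i ∈ S, ∑ j ∈ T, A i j) / (δ * S.card * T.card / Fintype.card V)) ≤
      ξ * (T.card * Real.log (Real.exp 1 * Fintype.card V / T.card))

/-- The heavy pairs of coordinates contribute `O(√d)` to the quadratic form of a matrix with
bounded row sums and the discrepancy property. -/
theorem heavy_sum_le {V : Type*} [Fintype V] [Nonempty V] {A : V → V → ℝ} (hA : ∀ i j, 0 ≤ A i j)
    (hsymm : ∀ i j, A i j = A j i) {r w M ξ : ℝ} (hr : 0 < r) (hw : 0 < w) (hM : 0 < M)
    (hξ : 0 ≤ ξ) (hrow : ∀ i, ∑ j, A i j ≤ w ^ 2 * r ^ 2) (hdisc : HasDiscrepancy A (M * r ^ 2) ξ)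
    {x : V → ℝ} (hx : ∑ i, x i ^ 2 ≤ 1) :
    ∑ i, ∑ j, (if r / Fintype.card V < |x i * x j| then A i j * |x i * x j| else 0) ≤
      (16 * w + 32 * M * (Real.exp 2 + 2) + 64 * ξ * w + 32 * ξ / Real.exp 1) * r := by
  classical
  set n : ℝ := (Fintype.card V : ℝ) with hn
  have hn0 : 0 < n := by rw [hn]; exact_mod_cast Fintype.card_pos
  have hsq : 0 < Real.sqrt n := Real.sqrt_pos.2 hn0
  -- the dyadic level of a nonzero coordinate
  have hlev : ∀ v : V, ∃ k : ℤ, x v ≠ 0 →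
      |x v| * Real.sqrt n ≤ 2 ^ k ∧ (2 : ℝ) ^ k < 2 * (|x v| * Real.sqrt n) := by
    intro v
    by_cases hv : x v = 0
    · exact ⟨0, fun h => absurd hv h⟩
    · obtain ⟨k, h1, h2⟩ := exists_mem_Ioc_zpow
        (mul_pos (abs_pos.2 hv) hsq) (one_lt_two : (1 : ℝ) < 2)
      refine ⟨k + 1, fun _ => ⟨h2, ?_⟩⟩
      rw [zpow_add_one₀ two_ne_zero]
      linarith
  choose l hl using hlev
  set U : Finset V := Finset.univ.filter fun v => x v ≠ 0 with hU
  set F : Finset ℤ := U.image l with hF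
  set S : ℤ → Finset V := fun k => U.filter fun v => l v = k with hS
  have hmemS : ∀ {k v}, v ∈ S k → x v ≠ 0 ∧ l v = k := by
    intro k v hv
    simpa [hS, hU] using hv
  set g : V → V → ℝ := fun i j => if r / n < |x i * x j| then A i j * |x i * x j| else 0 with hg
  have hg0 : ∀ i j, i ∉ U ∨ j ∉ U → g i j = 0 := by
    intro i j hij
    have h0 : x i * x j = 0 := by
      rcases hij with h | h
      · have : x i = 0 := by simpa [hU] using h
        rw [this, zero_mul]
      · have : x j = 0 := by simpa [hU] using h
        rw [this, mul_zero]
    simp only [hg, h0, abs_zero, mul_zero, ite_self]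
  have hfib : ∀ f : V → ℝ, ∑ v ∈ U, f v = ∑ k ∈ F, ∑ v ∈ S k, f v := fun f =>
    (Finset.sum_fiberwise_of_maps_to (fun v hv => Finset.mem_image_of_mem l hv) f).symm
  have hsplit : ∑ i, ∑ j, g i j = ∑ a ∈ F, ∑ b ∈ F, ∑ i ∈ S a, ∑ j ∈ S b, g i j := by
    have h1 : ∑ i, ∑ j, g i j = ∑ i ∈ U, ∑ j ∈ U, g i j := by
      rw [← Finset.sum_subset (Finset.subset_univ U) fun i _ hi =>
        Finset.sum_eq_zero fun j _ => hg0 i j (Or.inl hi)]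
      refine Finset.sum_congr rfl fun i _ => ?_
      rw [← Finset.sum_subset (Finset.subset_univ U) fun j _ hj => hg0 i j (Or.inr hj)]
    rw [h1, hfib]
    refine Finset.sum_congr rfl fun a _ => ?_
    exact (Finset.sum_congr rfl fun i _ => hfib _).trans Finset.sum_comm
  set e : ℤ → ℤ → ℝ := fun a b => ∑ i ∈ S a, ∑ j ∈ S b, A i j with he
  have hτ : ∀ a b, ∑ i ∈ S a, ∑ j ∈ S b, g i j ≤
      if r ≤ 2 ^ a * 2 ^ b then e a b * (2 ^ a * 2 ^ b) / n else 0 := by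
    intro a b
    have hprod : ∀ i ∈ S a, ∀ j ∈ S b, |x i * x j| ≤ 2 ^ a * 2 ^ b / n := by
      intro i hi j hj
      obtain ⟨hi0, rfl⟩ := hmemS hi
      obtain ⟨hj0, rfl⟩ := hmemS hj
      rw [le_div_iff₀ hn0, abs_mul]
      calc |x i| * |x j| * n = (|x i| * Real.sqrt n) * (|x j| * Real.sqrt n) := by
            nth_rw 1 [← Real.mul_self_sqrt hn0.le]; ring
        _ ≤ _ := mul_le_mul (hl i hi0).1 (hl j hj0).1 (by positivity) (by positivity)
    split_ifs with hab
    · rw [mul_div_assoc, he, Finset.sum_mul]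
      refine Finset.sum_le_sum fun i hi => ?_
      rw [Finset.sum_mul]
      refine Finset.sum_le_sum fun j hj => ?_
      have h0 : 0 ≤ A i j * (2 ^ a * 2 ^ b / n) := mul_nonneg (hA i j) (by positivity)
      simp only [hg]
      split_ifs
      · exact mul_le_mul_of_nonneg_left (hprod i hi j hj) (hA i j)
      · exact h0
    · refine (Finset.sum_eq_zero fun i hi => Finset.sum_eq_zero fun j hj => if_neg ?_).le
      rw [not_lt]
      refine (hprod i hi j hj).trans ?_
      have := (not_le.1 hab).le
      gcongr
  have hFne : ∀ a ∈ F, (S a).Nonempty := by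
    intro a ha
    obtain ⟨v, hv, rfl⟩ := Finset.mem_image.1 ha
    exact ⟨v, by simp [hS, hv]⟩
  have hsum : ∑ a ∈ F, ((S a).card : ℝ) * (2 ^ a) ^ 2 / n ≤ 4 := by
    calc ∑ a ∈ F, ((S a).card : ℝ) * (2 ^ a) ^ 2 / n ≤ ∑ a ∈ F, ∑ v ∈ S a, 4 * x v ^ 2 := by
          refine Finset.sum_le_sum fun a _ => ?_
          rw [mul_div_assoc, ← nsmul_eq_mul, ← Finset.sum_const]
          refine Finset.sum_le_sum fun v hv => ?_
          obtain ⟨hv0, rfl⟩ := hmemS hv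
          rw [div_le_iff₀ hn0]
          calc ((2 : ℝ) ^ l v) ^ 2 ≤ (2 * (|x v| * Real.sqrt n)) ^ 2 := by
                gcongr
                exact (hl v hv0).2.le
            _ = 4 * x v ^ 2 * n := by
                rw [mul_pow, mul_pow, sq_abs, Real.sq_sqrt hn0.le]; ring
      _ = ∑ v ∈ U, 4 * x v ^ 2 := (hfib _).symm
      _ ≤ ∑ v, 4 * x v ^ 2 :=
          Finset.sum_le_sum_of_subset_of_nonneg (Finset.subset_univ _) fun v _ _ => by positivity
      _ ≤ 4 := by rw [← Finset.mul_sum]; linarith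
  rw [hsplit]
  calc _ ≤ ∑ a ∈ F, ∑ b ∈ F, (if r ≤ 2 ^ a * 2 ^ b then e a b * (2 ^ a * 2 ^ b) / n else 0) :=
        Finset.sum_le_sum fun a _ => Finset.sum_le_sum fun b _ => hτ a b
    _ ≤ _ := by
      refine heavy_levels_le (s := fun a => ((S a).card : ℝ)) ?_ hn0 ?_ hr hw hM hξ hsum ?_ ?_ ?_ ?_
      · intro a ha
        exact_mod_cast (hFne a ha).card_pos
      · intro a _
        rw [hn]
        exact_mod_cast Finset.card_le_univ (S a)
      · exact fun a b => Finset.sum_nonneg fun i _ => Finset.sum_nonneg fun j _ => hA i j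
      · intro a b
        simp only [he]
        rw [Finset.sum_comm]
        exact Finset.sum_congr rfl fun j _ => Finset.sum_congr rfl fun i _ => hsymm _ _
      · intro a b
        simp only [he]
        rw [← nsmul_eq_mul, ← Finset.sum_const]
        exact Finset.sum_le_sum fun i _ => (Finset.sum_le_sum_of_subset_of_nonneg
          (Finset.subset_univ _) fun j _ _ => hA i j).trans (hrow i)
      · intro a ha b _ hab
        exact hdisc (S a) (S b) (hFne a ha) (by exact_mod_cast hab)

end Heavy

/-! ### Counting subsets -/

section Counting

/-- `t log (e n / t)`, an upper bound for the logarithm of the number of `t`-subsets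
of an `n`-set. -/
noncomputable def subsetEntropy (n t : ℕ) : ℝ := t * Real.log (Real.exp 1 * n / t)

theorem subsetEntropy_eq {n t : ℕ} (ht : 0 < t) (hn : 0 < n) :
    subsetEntropy n t = t * (1 + Real.log n - Real.log t) := by
  have h1 : (t : ℝ) ≠ 0 := by positivity
  have h2 : (n : ℝ) ≠ 0 := by positivity
  rw [subsetEntropy, Real.log_div (by positivity) h1, Real.log_mul (by positivity) h2,
    Real.log_exp]

/-- There are at most `(e n / t) ^ t` subsets with at most `t` elements. -/
theorem card_filter_card_le {V : Type*} [Fintype V] {t : ℕ} (ht : 0 < t)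
    (htn : t ≤ Fintype.card V) :
    (((Finset.univ : Finset (Finset V)).filter fun S => S.card ≤ t).card : ℝ) ≤
      Real.exp (subsetEntropy (Fintype.card V) t) := by
  set n := Fintype.card V with hn
  have hn0 : 0 < n := ht.trans_le htn
  have ht' : (0 : ℝ) < t := by exact_mod_cast ht
  have hn' : (0 : ℝ) < n := by exact_mod_cast hn0
  have h1 : (1 : ℝ) ≤ n / t := (one_le_div ht').2 (by exact_mod_cast htn)
  set y : ℝ := t / n with hy
  have hy0 : 0 < y := by positivity
  have hsum : ∑ S : Finset V, y ^ S.card = (y + 1) ^ n := by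
    have := Finset.sum_pow_mul_eq_add_pow y 1 (Finset.univ : Finset V)
    simpa [Finset.card_univ, hn] using this
  calc (((Finset.univ : Finset (Finset V)).filter fun S => S.card ≤ t).card : ℝ)
      = ∑ S ∈ (Finset.univ : Finset (Finset V)).filter (fun S => S.card ≤ t), (1 : ℝ) := by simp
    _ ≤ ∑ S ∈ (Finset.univ : Finset (Finset V)).filter (fun S => S.card ≤ t),
          ((n : ℝ) / t) ^ t * y ^ S.card := by
        -- `(n / t) ^ t * (t / n) ^ |S| ≥ 1` because `|S| ≤ t ≤ n`
        refine Finset.sum_le_sum fun S hS => ?_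
        have hS' : S.card ≤ t := (Finset.mem_filter.1 hS).2
        have e : y = ((n : ℝ) / t)⁻¹ := by rw [hy, inv_div]
        rw [e, inv_pow, ← div_eq_mul_inv, one_le_div (by positivity)]
        exact pow_le_pow_right₀ h1 hS'
    _ ≤ ∑ S : Finset V, ((n : ℝ) / t) ^ t * y ^ S.card :=
        Finset.sum_le_sum_of_subset_of_nonneg (Finset.subset_univ _) fun S _ _ => by positivity
    _ = ((n : ℝ) / t) ^ t * (y + 1) ^ n := by rw [← Finset.mul_sum, hsum]
    _ ≤ ((n : ℝ) / t) ^ t * Real.exp y ^ n := by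
        gcongr
        exact Real.add_one_le_exp y
    _ = Real.exp (subsetEntropy n t) := by
        rw [← Real.exp_nat_mul, show (n : ℝ) * y = t by rw [hy]; field_simp,
          subsetEntropy, ← Real.log_pow, Real.exp_log (by positivity), mul_div_assoc, mul_pow,
          ← Real.exp_nat_mul, mul_one, mul_comm]

theorem one_add_log_le_subsetEntropy {n t : ℕ} (ht : 0 < t) (htn : t ≤ n) :
    1 + Real.log n ≤ subsetEntropy n t := by
  rw [subsetEntropy_eq ht (ht.trans_le htn)]
  have ht' : (1 : ℝ) ≤ t := by exact_mod_cast ht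
  have h1 : Real.log t ≤ t - 1 := Real.log_le_sub_one_of_pos (by linarith)
  have h2 : Real.log t ≤ Real.log n :=
    Real.log_le_log (by linarith) (by exact_mod_cast htn)
  nlinarith [mul_nonneg (sub_nonneg.2 ht') (sub_nonneg.2 h2)]

/-- The union bound over all pairs of sets `S`, `T` with `0 < |S| ≤ |T|`. -/
theorem sum_exp_neg_subsetEntropy_le (V : Type*) [Fintype V] [Nonempty V] :
    ∑ T : Finset V, ∑ S : Finset V, (if S.Nonempty ∧ S.card ≤ T.card then
      Real.exp (-(14 * subsetEntropy (Fintype.card V) T.card)) else 0) ≤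
      ((Fintype.card V : ℝ) ^ 10)⁻¹ := by
  classical
  set n := Fintype.card V with hn
  have hn0 : 0 < n := Fintype.card_pos
  have hn' : (0 : ℝ) < n := by exact_mod_cast hn0
  set f : ℕ → ℝ := fun t => if t = 0 then 0 else Real.exp (-(13 * subsetEntropy n t)) with hf
  have hinner : ∀ T : Finset V, ∑ S : Finset V, (if S.Nonempty ∧ S.card ≤ T.card then
      Real.exp (-(14 * subsetEntropy n T.card)) else 0) ≤ f T.card := by
    intro T
    rcases Nat.eq_zero_or_pos T.card with h0 | hpos
    · simp only [hf, h0, if_true]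
      refine (Finset.sum_eq_zero fun S _ => if_neg ?_).le
      rintro ⟨hS, hS'⟩
      have := hS.card_pos
      omega
    · simp only [hf, hpos.ne', if_false]
      have hcard := card_filter_card_le (V := V) hpos (Finset.card_le_univ T)
      calc _ ≤ ∑ S : Finset V, (if S.card ≤ T.card then
            Real.exp (-(14 * subsetEntropy n T.card)) else 0) := by
            refine Finset.sum_le_sum fun S _ => ?_
            by_cases h : S.card ≤ T.card
            · rw [if_pos h]
              split_ifs
              · exact le_rfl
              · positivity
            · rw [if_neg h, if_neg fun h' => h h'.2]
        _ = (((Finset.univ : Finset (Finset V)).filter fun S => S.card ≤ T.card).card : ℝ) *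
            Real.exp (-(14 * subsetEntropy n T.card)) := by
            rw [← Finset.sum_filter, Finset.sum_const, nsmul_eq_mul]
        _ ≤ Real.exp (subsetEntropy n T.card) * Real.exp (-(14 * subsetEntropy n T.card)) := by
            gcongr
        _ = _ := by rw [← Real.exp_add]; ring_nf
  have hterm : ∀ t ∈ Finset.range (n + 1), n.choose t • f t ≤
      if t = 0 then 0 else Real.exp (-(12 * (1 + Real.log n))) := by
    intro t ht
    rcases Nat.eq_zero_or_pos t with rfl | hpos
    · simp [hf]
    · have htn : t ≤ n := Nat.lt_succ_iff.1 (Finset.mem_range.1 ht)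
      simp only [hf, hpos.ne', if_false, nsmul_eq_mul]
      have hchoose : ((n.choose t : ℕ) : ℝ) ≤ Real.exp (subsetEntropy n t) := by
        refine le_trans ?_ (card_filter_card_le (V := V) hpos htn)
        rw [hn, ← Finset.card_univ, ← Finset.card_powersetCard]
        refine Nat.cast_le.2 (Finset.card_le_card fun S hS => ?_)
        simpa using (Finset.mem_powersetCard.1 hS).2.le
      calc _ ≤ Real.exp (subsetEntropy n t) * Real.exp (-(13 * subsetEntropy n t)) := by gcongr
        _ = Real.exp (-(12 * subsetEntropy n t)) := by rw [← Real.exp_add]; ring_nf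
        _ ≤ _ := by
          refine Real.exp_le_exp.2 ?_
          linarith [one_add_log_le_subsetEntropy hpos htn]
  calc _ ≤ ∑ T : Finset V, f T.card := Finset.sum_le_sum fun T _ => hinner T
    _ = ∑ t ∈ Finset.range (n + 1), n.choose t • f t := by
        have := Finset.sum_powerset_apply_card f (x := (Finset.univ : Finset V))
        rwa [Finset.powerset_univ, Finset.card_univ] at this
    _ ≤ ∑ t ∈ Finset.range (n + 1), if t = 0 then 0 else Real.exp (-(12 * (1 + Real.log n))) :=
        Finset.sum_le_sum hterm
    _ = n * Real.exp (-(12 * (1 + Real.log n))) := by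
        rw [Finset.sum_range_succ']
        simp
    _ ≤ n * ((n : ℝ) ^ 11)⁻¹ := by
        gcongr
        rw [← Real.exp_log (show (0 : ℝ) < ((n : ℝ) ^ 11)⁻¹ by positivity), Real.log_inv,
          Real.log_pow]
        refine Real.exp_le_exp.2 ?_
        have : 0 ≤ Real.log n := Real.log_natCast_nonneg n
        push_cast
        linarith
    _ = _ := by field_simp

end Counting

/-! ### Random hypergraphs with independent hyperedges -/

section Concentration

open scoped Classical in
/-- The `(i, j)` entry of the adjacency matrix of a single hyperedge `e`. -/
noncomputable def pairIndicator {V : Type*} (e : Finset V) (i j : V) : ℝ :=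
  if i ≠ j ∧ i ∈ e ∧ j ∈ e then 1 else 0

variable {V : Type*}

theorem pairIndicator_nonneg (e : Finset V) (i j : V) : 0 ≤ pairIndicator e i j := by
  unfold pairIndicator; split_ifs <;> norm_num

theorem pairIndicator_symm (e : Finset V) (i j : V) :
    pairIndicator e i j = pairIndicator e j i := by
  unfold pairIndicator
  congr 1
  exact propext (by rw [ne_comm]; tauto)

theorem pairIndicator_sq (e : Finset V) (i j : V) :
    pairIndicator e i j ^ 2 = pairIndicator e i j := by
  unfold pairIndicator; split_ifs <;> norm_num

theorem sum_pairIndicator_right_le [Fintype V] [DecidableEq V] (e : Finset V) (i : V) :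
    ∑ j, pairIndicator e i j ≤ (e.card : ℝ) * (if i ∈ e then 1 else 0) := by
  split_ifs with hi
  · rw [mul_one]
    calc ∑ j, pairIndicator e i j ≤ ∑ j, if j ∈ e then (1 : ℝ) else 0 := by
          refine Finset.sum_le_sum fun j _ => ?_
          unfold pairIndicator
          split_ifs with h1 h2
          · exact le_rfl
          · exact absurd h1.2.2 h2
          · exact zero_le_one
          · exact le_rfl
      _ = e.card := by simp
  · rw [mul_zero]
    exact (Finset.sum_eq_zero fun j _ => if_neg fun h => hi h.2.1).le

theorem sum_pairIndicator_le [Fintype V] {e : Finset V} {M : ℝ} (he : (e.card : ℝ) ≤ M) :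
    ∑ i, ∑ j, pairIndicator e i j ≤ M ^ 2 := by
  classical
  calc ∑ i, ∑ j, pairIndicator e i j ≤ ∑ i, (e.card : ℝ) * (if i ∈ e then 1 else 0) :=
        Finset.sum_le_sum fun i _ => sum_pairIndicator_right_le e i
    _ = (e.card : ℝ) * e.card := by rw [← Finset.mul_sum]; simp
    _ ≤ M ^ 2 := by rw [sq]; exact mul_self_le_mul_self (Nat.cast_nonneg _) he

theorem abs_sum_mul_pairIndicator_le [Fintype V] {e : Finset V} {M : ℝ} (he : (e.card : ℝ) ≤ M)
    {c : V → V → ℝ} {K : ℝ} (hK : 0 ≤ K) (hc : ∀ i j, |c i j| ≤ K) :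
    |∑ i, ∑ j, c i j * pairIndicator e i j| ≤ K * M ^ 2 := by
  calc |∑ i, ∑ j, c i j * pairIndicator e i j|
      ≤ ∑ i, |∑ j, c i j * pairIndicator e i j| := Finset.abs_sum_le_sum_abs _ _
    _ ≤ ∑ i, ∑ j, |c i j * pairIndicator e i j| :=
        Finset.sum_le_sum fun i _ => Finset.abs_sum_le_sum_abs _ _
    _ ≤ ∑ i, ∑ j, K * pairIndicator e i j := by
        refine Finset.sum_le_sum fun i _ => Finset.sum_le_sum fun j _ => ?_
        rw [abs_mul, abs_of_nonneg (pairIndicator_nonneg e i j)]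
        exact mul_le_mul_of_nonneg_right (hc i j) (pairIndicator_nonneg e i j)
    _ = K * ∑ i, ∑ j, pairIndicator e i j := by simp only [Finset.mul_sum]
    _ ≤ K * M ^ 2 := mul_le_mul_of_nonneg_left (sum_pairIndicator_le he) hK

/-- Cauchy–Schwarz, keeping only the pairs of vertices inside the hyperedge. -/
theorem sq_sum_mul_pairIndicator_le [Fintype V] {e : Finset V} {M : ℝ} (he : (e.card : ℝ) ≤ M)
    (c : V → V → ℝ) :
    (∑ i, ∑ j, c i j * pairIndicator e i j) ^ 2 ≤
      M ^ 2 * ∑ i, ∑ j, c i j ^ 2 * pairIndicator e i j := by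
  have h := Finset.sum_mul_sq_le_sq_mul_sq (Finset.univ : Finset (V × V))
    (fun p => pairIndicator e p.1 p.2) (fun p => c p.1 p.2 * pairIndicator e p.1 p.2)
  simp only [mul_pow, pairIndicator_sq, Fintype.sum_prod_type] at h
  have e1 : ∀ i j, pairIndicator e i j * (c i j * pairIndicator e i j) =
      c i j * pairIndicator e i j := fun i j => by
    rw [mul_comm, mul_assoc, ← sq, pairIndicator_sq]
  simp only [e1] at h
  refine h.trans (mul_le_mul_of_nonneg_right (sum_pairIndicator_le he) ?_)
  exact Finset.sum_nonneg fun i _ => Finset.sum_nonneg fun j _ =>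
    mul_nonneg (sq_nonneg _) (pairIndicator_nonneg e i j)

end Concentration

section Concentration

variable {Ω V P : Type*} [MeasurableSpace Ω] [Fintype V] [Fintype P] {μ : Measure Ω}
  [IsProbabilityMeasure μ] {E : P → Set Ω} {e : P → Finset V}

/-- The adjacency matrix of the random hypergraph in which the hyperedge `e p` is present on the
event `E p`. -/
noncomputable def randomAdjacency {Ω V P : Type*} [Fintype P] (E : P → Set Ω) (e : P → Finset V)
    (ω : Ω) (i j : V) : ℝ :=
  weightedCount E (fun p => pairIndicator (e p) i j) ω

theorem weightedCount_nonneg {Ω P : Type*} [Fintype P] (E : P → Set Ω) {b : P → ℝ}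
    (hb : ∀ p, 0 ≤ b p) (ω : Ω) : 0 ≤ weightedCount E b ω :=
  Finset.sum_nonneg fun p _ =>
    mul_nonneg (hb p) (Set.indicator_nonneg (fun _ _ => zero_le_one) ω)

theorem weightedCount_mono {Ω P : Type*} [Fintype P] (E : P → Set Ω) {b b' : P → ℝ}
    (hb : ∀ p, b p ≤ b' p) (ω : Ω) : weightedCount E b ω ≤ weightedCount E b' ω :=
  Finset.sum_le_sum fun p _ =>
    mul_le_mul_of_nonneg_right (hb p) (Set.indicator_nonneg (fun _ _ => zero_le_one) ω)

theorem sum_mul_weightedCount {Ω P ι : Type*} [Fintype P] (E : P → Set Ω) (s : Finset ι)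
    (c : ι → ℝ) (b : ι → P → ℝ) (ω : Ω) :
    ∑ i ∈ s, c i * weightedCount E (b i) ω =
      weightedCount E (fun p => ∑ i ∈ s, c i * b i p) ω := by
  simp only [weightedCount, Finset.mul_sum, Finset.sum_mul, mul_assoc]
  exact Finset.sum_comm

theorem sum_weightedCount {Ω P ι : Type*} [Fintype P] (E : P → Set Ω) (s : Finset ι)
    (b : ι → P → ℝ) (ω : Ω) :
    ∑ i ∈ s, weightedCount E (b i) ω = weightedCount E (fun p => ∑ i ∈ s, b i p) ω := by
  simpa using sum_mul_weightedCount E s (fun _ => 1) b ω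

/-- The light pairs of coordinates: for a fixed vector their contribution to the quadratic form
of the centred adjacency matrix is `O(√d)` up to an exponentially small probability. -/
theorem light_le [Nonempty V] (hE : ∀ p, MeasurableSet (E p)) (hind : iIndepSet E μ)
    {M r : ℝ} (hM : 2 ≤ M) (hr : 0 < r) (he : ∀ p, ((e p).card : ℝ) ≤ M)
    (hcodeg : ∀ i j, ∑ p, pairIndicator (e p) i j * μ.real (E p) ≤ M * r ^ 2 / Fintype.card V)
    {c : V → V → ℝ} (hc : ∀ i j, |c i j| ≤ r / Fintype.card V) (hc1 : ∑ i, ∑ j, c i j ^ 2 ≤ 1) :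
    μ.real {ω | 5 * M ^ 2 * r ≤ |∑ i, ∑ j, c i j *
      (randomAdjacency E e ω i j - ∑ p, pairIndicator (e p) i j * μ.real (E p))|} ≤
      2 * Real.exp (-(9 / 2 * Fintype.card V)) := by
  set n : ℝ := (Fintype.card V : ℝ) with hn
  have hn0 : 0 < n := by rw [hn]; exact_mod_cast Fintype.card_pos
  have hM0 : 0 < M := by linarith
  set Y : P → ℝ := fun p => ∑ i, ∑ j, c i j * pairIndicator (e p) i j with hY
  -- the largest exponential rate allowed by `|Y p| ≤ M ^ 2 * r / n`
  set l : ℝ := n / (M ^ 2 * r) with hl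
  have hl0 : 0 < l := by positivity
  have hYl : ∀ p, |l * Y p| ≤ 1 := by
    intro p
    have := abs_sum_mul_pairIndicator_le (he p) (show 0 ≤ r / n by positivity) hc
    rw [abs_mul, abs_of_pos hl0]
    calc l * |Y p| ≤ l * (r / n * M ^ 2) := by gcongr
      _ = 1 := by rw [hl]; field_simp
  have hσ : ∑ p, μ.real (E p) * Y p ^ 2 ≤ M ^ 3 * r ^ 2 / n := by
    calc ∑ p, μ.real (E p) * Y p ^ 2
        ≤ ∑ p, μ.real (E p) * (M ^ 2 * ∑ i, ∑ j, c i j ^ 2 * pairIndicator (e p) i j) :=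
          Finset.sum_le_sum fun p _ =>
            mul_le_mul_of_nonneg_left (sq_sum_mul_pairIndicator_le (he p) c) measureReal_nonneg
      _ = M ^ 2 * ∑ i, ∑ j, c i j ^ 2 * ∑ p, pairIndicator (e p) i j * μ.real (E p) := by
          simp only [Finset.mul_sum]
          rw [Finset.sum_comm]
          refine Finset.sum_congr rfl fun i _ => ?_
          rw [Finset.sum_comm]
          exact Finset.sum_congr rfl fun j _ => Finset.sum_congr rfl fun p _ => by ring
      _ ≤ M ^ 2 * ∑ i, ∑ j, c i j ^ 2 * (M * r ^ 2 / n) := by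
          gcongr with i _ j _
          exact hcodeg i j
      _ = M ^ 2 * (M * r ^ 2 / n) * ∑ i, ∑ j, c i j ^ 2 := by
          simp only [← Finset.sum_mul]; ring
      _ ≤ M ^ 2 * (M * r ^ 2 / n) * 1 := by gcongr
      _ = _ := by ring
  have hsum : ∀ ω, ∑ i, ∑ j, c i j *
      (randomAdjacency E e ω i j - ∑ p, pairIndicator (e p) i j * μ.real (E p)) =
      weightedCount E Y ω - ∑ p, Y p * μ.real (E p) := by
    intro ω
    simp only [mul_sub, Finset.sum_sub_distrib, randomAdjacency, sum_mul_weightedCount,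
      sum_weightedCount]
    congr 1
    simp only [hY, Finset.mul_sum, Finset.sum_mul]
    symm
    rw [Finset.sum_comm]
    refine Finset.sum_congr rfl fun i _ => ?_
    rw [Finset.sum_comm]
    exact Finset.sum_congr rfl fun j _ => Finset.sum_congr rfl fun p _ => by ring
  simp only [hsum]
  refine (centered_abs hE hind hl0 hYl hσ).trans ?_
  gcongr
  have e1 : l * (5 * M ^ 2 * r) = 5 * n := by rw [hl]; field_simp
  have e2 : l ^ 2 * (M ^ 3 * r ^ 2 / n) = n / M := by rw [hl]; field_simp
  have : n / M ≤ n / 2 := by gcongr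
  rw [e1, e2]
  linarith

/-- All degrees are of order `d` with high probability. -/
theorem degree_le [DecidableEq V] [Nonempty V] (hE : ∀ p, MeasurableSet (E p)) (hind : iIndepSet E μ) {d k : ℝ}
    (hdeg : ∀ i, ∑ p, (if i ∈ e p then 1 else 0) * μ.real (E p) ≤ d) (hk : 1 ≤ k)
    (hdk : 11 * Real.log (Fintype.card V) ≤ d * (k * Real.log k - k + 1)) :
    μ.real {ω | ∃ i, k * d ≤ weightedCount E (fun p => if i ∈ e p then 1 else 0) ω} ≤
      ((Fintype.card V : ℝ) ^ 10)⁻¹ := by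
  set n : ℝ := (Fintype.card V : ℝ) with hn
  have hn0 : 0 < n := by rw [hn]; exact_mod_cast Fintype.card_pos
  have h1 : ∀ i, μ.real {ω | k * d ≤ weightedCount E (fun p => if i ∈ e p then 1 else 0) ω} ≤
      (n ^ 11)⁻¹ := by
    intro i
    refine (chernoff_upper hE hind zero_lt_one (fun p => by split_ifs <;> norm_num)
      (fun p => by split_ifs <;> norm_num) (hdeg i) hk).trans ?_
    rw [← Real.exp_log (show (0 : ℝ) < (n ^ 11)⁻¹ by positivity), Real.log_inv, Real.log_pow,
      div_one]
    refine Real.exp_le_exp.2 (neg_le_neg ?_)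
    exact_mod_cast hdk
  have h2 : {ω | ∃ i, k * d ≤ weightedCount E (fun p => if i ∈ e p then 1 else 0) ω} =
      ⋃ i, {ω | k * d ≤ weightedCount E (fun p => if i ∈ e p then 1 else 0) ω} := by
    ext ω; simp
  rw [h2]
  calc _ ≤ ∑ i : V, μ.real {ω | k * d ≤ weightedCount E (fun p => if i ∈ e p then 1 else 0) ω} :=
        measureReal_iUnion_fintype_le _
    _ ≤ ∑ _i : V, (n ^ 11)⁻¹ := Finset.sum_le_sum fun i _ => h1 i
    _ = n * (n ^ 11)⁻¹ := by rw [Finset.sum_const, nsmul_eq_mul, Finset.card_univ]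
    _ = _ := by field_simp

/-- The adjacency matrix has the discrepancy property with high probability. -/
theorem discrepancy_le [Nonempty V] (hE : ∀ p, MeasurableSet (E p)) (hind : iIndepSet E μ)
    {M d : ℝ} (hM : 0 < M) (hd : 0 < d) (he : ∀ p, ((e p).card : ℝ) ≤ M)
    (hcodeg : ∀ i j, ∑ p, pairIndicator (e p) i j * μ.real (E p) ≤ M * d / Fintype.card V) :
    μ.real {ω | ¬ HasDiscrepancy (randomAdjacency E e ω) (M * d) (28 * M ^ 2)} ≤
      ((Fintype.card V : ℝ) ^ 10)⁻¹ := by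
  classical
  set n : ℝ := (Fintype.card V : ℝ) with hn
  have hn0 : 0 < n := by rw [hn]; exact_mod_cast Fintype.card_pos
  set X : Finset V → Finset V → Ω → ℝ := fun S T ω =>
    ∑ i ∈ S, ∑ j ∈ T, randomAdjacency E e ω i j with hX
  set B : Finset V → Finset V → Set Ω := fun S T =>
    {ω | (S.Nonempty ∧ S.card ≤ T.card) ∧ Real.exp 2 * (M * d * S.card * T.card / n) < X S T ω ∧
      2 * M ^ 2 * (14 * subsetEntropy (Fintype.card V) T.card) <
        X S T ω * Real.log (X S T ω / (M * d * S.card * T.card / n))} with hB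
  have hsub : {ω | ¬ HasDiscrepancy (randomAdjacency E e ω) (M * d) (28 * M ^ 2)} ⊆
      ⋃ T, ⋃ S, B S T := by
    intro ω hω
    have hω' : ¬ HasDiscrepancy (randomAdjacency E e ω) (M * d) (28 * M ^ 2) := hω
    unfold HasDiscrepancy at hω'
    push Not at hω'
    obtain ⟨S, T, hS, hST, h1, h2⟩ := hω'
    refine Set.mem_iUnion.2 ⟨T, Set.mem_iUnion.2 ⟨S, ⟨hS, hST⟩, h1, ?_⟩⟩
    refine lt_of_eq_of_lt ?_ h2
    rw [subsetEntropy]; ring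
  have hBle : ∀ S T, μ.real (B S T) ≤ if S.Nonempty ∧ S.card ≤ T.card then
      Real.exp (-(14 * subsetEntropy (Fintype.card V) T.card)) else 0 := by
    intro S T
    split_ifs with hST
    · have hs : (0 : ℝ) < S.card := by exact_mod_cast hST.1.card_pos
      have ht : (0 : ℝ) < T.card := by exact_mod_cast hST.1.card_pos.trans_le hST.2
      have hXe : ∀ ω, X S T ω =
          weightedCount E (fun p => ∑ i ∈ S, ∑ j ∈ T, pairIndicator (e p) i j) ω := by
        intro ω
        simp only [hX, randomAdjacency, sum_weightedCount]
      have hmean : ∑ p, (∑ i ∈ S, ∑ j ∈ T, pairIndicator (e p) i j) * μ.real (E p) ≤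
          M * d * S.card * T.card / n := by
        calc _ = ∑ i ∈ S, ∑ j ∈ T, ∑ p, pairIndicator (e p) i j * μ.real (E p) := by
              simp only [Finset.sum_mul]
              rw [Finset.sum_comm]
              exact Finset.sum_congr rfl fun i _ => Finset.sum_comm
          _ ≤ ∑ _i ∈ S, ∑ _j ∈ T, M * d / n :=
              Finset.sum_le_sum fun i _ => Finset.sum_le_sum fun j _ => hcodeg i j
          _ = _ := by simp only [Finset.sum_const, nsmul_eq_mul]; ring
      have h0 : ∀ p, 0 ≤ ∑ i ∈ S, ∑ j ∈ T, pairIndicator (e p) i j := fun p =>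
        Finset.sum_nonneg fun i _ => Finset.sum_nonneg fun j _ => pairIndicator_nonneg _ _ _
      have hle : ∀ p, ∑ i ∈ S, ∑ j ∈ T, pairIndicator (e p) i j ≤ M ^ 2 := by
        intro p
        refine le_trans ?_ (sum_pairIndicator_le (he p))
        refine (Finset.sum_le_sum fun i _ => Finset.sum_le_sum_of_subset_of_nonneg
          (Finset.subset_univ T) fun j _ _ => pairIndicator_nonneg _ _ _).trans ?_
        exact Finset.sum_le_sum_of_subset_of_nonneg (Finset.subset_univ S) fun i _ _ =>
          Finset.sum_nonneg fun j _ => pairIndicator_nonneg _ _ _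
      refine le_trans (measureReal_mono ?_) (chernoff_entropy hE hind (by positivity : 0 < M ^ 2)
        h0 hle (by positivity) hmean (14 * subsetEntropy (Fintype.card V) T.card))
      rintro ω ⟨-, h1, h2⟩
      rw [hXe] at h1 h2
      exact ⟨h1, h2⟩
    · have : B S T = ∅ := Set.eq_empty_of_forall_notMem fun ω hω => hST hω.1
      rw [this]; simp
  calc _ ≤ μ.real (⋃ T, ⋃ S, B S T) := measureReal_mono hsub
    _ ≤ ∑ T, μ.real (⋃ S, B S T) := measureReal_iUnion_fintype_le _
    _ ≤ ∑ T, ∑ S, μ.real (B S T) :=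
        Finset.sum_le_sum fun T _ => measureReal_iUnion_fintype_le _
    _ ≤ _ := Finset.sum_le_sum fun T _ => Finset.sum_le_sum fun S _ => hBle S T
    _ ≤ _ := sum_exp_neg_subsetEntropy_le V

end Concentration

/-! ### Concentration of the quadratic form -/

section Concentration

/-- The quadratic form of `A - B` is split into light pairs (where cancellations are used) and heavy
pairs (where `A` and `B` are estimated separately). -/
theorem quadForm_le {V : Type*} [Fintype V] [Nonempty V] {A B : V → V → ℝ} {r M L H : ℝ}
    (hr : 0 < r) (hA : ∀ i j, 0 ≤ A i j) (hB : ∀ i j, 0 ≤ B i j) (hM : 0 ≤ M)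
    (hBle : ∀ i j, B i j ≤ M * r ^ 2 / Fintype.card V) {x : V → ℝ} (hx : ∑ i, x i ^ 2 ≤ 1)
    (hlight : |∑ i, ∑ j, (if |x i * x j| ≤ r / Fintype.card V then x i * x j else 0) *
      (A i j - B i j)| ≤ L)
    (hheavy : ∑ i, ∑ j,
      (if r / Fintype.card V < |x i * x j| then A i j * |x i * x j| else 0) ≤ H) :
    |∑ i, ∑ j, x i * x j * (A i j - B i j)| ≤ L + H + M * r := by
  set n : ℝ := (Fintype.card V : ℝ) with hn
  have hn0 : 0 < n := by rw [hn]; exact_mod_cast Fintype.card_pos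
  have hB' : ∑ i, ∑ j, (if r / n < |x i * x j| then B i j * |x i * x j| else 0) ≤ M * r := by
    calc _ ≤ ∑ i, ∑ j, M * r * (x i ^ 2 * x j ^ 2) := by
          refine Finset.sum_le_sum fun i _ => Finset.sum_le_sum fun j _ => ?_
          split_ifs with h
          · rw [div_lt_iff₀ hn0] at h
            calc B i j * |x i * x j| ≤ M * r ^ 2 / n * |x i * x j| := by
                  gcongr
                  exact hBle i j
              _ = M * r * (r * |x i * x j|) / n := by ring
              _ ≤ M * r * (|x i * x j| * n * |x i * x j|) / n := by gcongr
              _ = M * r * (|x i * x j| ^ 2) := by field_simp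
              _ = _ := by rw [sq_abs, mul_pow]
          · positivity
      _ = M * r * ((∑ i, x i ^ 2) * ∑ j, x j ^ 2) := by
          rw [Finset.sum_mul_sum]
          simp only [Finset.mul_sum]
      _ ≤ M * r * (1 * 1) := by gcongr
      _ = _ := by ring
  have hsplit : ∑ i, ∑ j, x i * x j * (A i j - B i j) =
      ∑ i, ∑ j, (if |x i * x j| ≤ r / n then x i * x j else 0) * (A i j - B i j) +
      ∑ i, ∑ j, (if r / n < |x i * x j| then x i * x j else 0) * (A i j - B i j) := by
    simp only [← Finset.sum_add_distrib]
    refine Finset.sum_congr rfl fun i _ => Finset.sum_congr rfl fun j _ => ?_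
    by_cases h : |x i * x j| ≤ r / n
    · rw [if_pos h, if_neg h.not_gt]; ring
    · rw [if_neg h, if_pos (not_le.1 h)]; ring
  have hrest : |∑ i, ∑ j, (if r / n < |x i * x j| then x i * x j else 0) * (A i j - B i j)| ≤
      H + M * r := by
    calc _ ≤ ∑ i, |∑ j, (if r / n < |x i * x j| then x i * x j else 0) * (A i j - B i j)| :=
          Finset.abs_sum_le_sum_abs _ _
      _ ≤ ∑ i, ∑ j, |(if r / n < |x i * x j| then x i * x j else 0) * (A i j - B i j)| :=
          Finset.sum_le_sum fun i _ => Finset.abs_sum_le_sum_abs _ _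
      _ ≤ ∑ i, ∑ j, ((if r / n < |x i * x j| then A i j * |x i * x j| else 0) +
            (if r / n < |x i * x j| then B i j * |x i * x j| else 0)) := by
          refine Finset.sum_le_sum fun i _ => Finset.sum_le_sum fun j _ => ?_
          split_ifs with h
          · rw [abs_mul]
            have : |A i j - B i j| ≤ A i j + B i j :=
              abs_le.2 ⟨by linarith [hA i j], by linarith [hB i j]⟩
            calc _ ≤ |x i * x j| * (A i j + B i j) := by gcongr
              _ = _ := by ring
          · simp
      _ ≤ H + M * r := by
          simp only [Finset.sum_add_distrib]
          linarith
  rw [hsplit]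
  refine (abs_add_le _ _).trans ?_
  linarith

/-- The constants of `heavy_sum_le` with `ξ = 28 M²` fit into `β₀ √β₁`: only the first and third
terms carry the factor `w = √β₁` on the left, and `w ≥ √2` leaves enough room for the others. -/
theorem heavy_const_le (M : ℕ) (hM : 2 ≤ M) {w : ℝ} (hw : Real.sqrt 2 ≤ w) :
    16 * w + 32 * M * (Real.exp 2 + 2) + 64 * (28 * (M : ℝ) ^ 2) * w +
      32 * (28 * (M : ℝ) ^ 2) / Real.exp 1 ≤ beta0 M * w := by
  have hw1 : 1.4 ≤ w := le_trans (Real.le_sqrt_of_sq_le (by norm_num)) hw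
  have he := Real.exp_one_lt_d9
  have he' := Real.exp_one_gt_d9
  have hM0 : (0 : ℝ) ≤ M := Nat.cast_nonneg M
  have h2 : Real.exp 2 = Real.exp 1 * Real.exp 1 := by rw [← Real.exp_add]; norm_num
  have h2' : 7 < Real.exp 2 := by rw [h2]; nlinarith
  have k1 : Real.exp 2 + 2 ≤ (1 + Real.exp 2) * w := by nlinarith
  have k2 : 32 / Real.exp 1 ≤ 64 * Real.exp (-2) * w := by
    rw [Real.exp_neg, h2, div_le_iff₀ (by positivity)]
    field_simp
    linarith
  have m1 := mul_le_mul_of_nonneg_left k1 (show (0 : ℝ) ≤ 32 * M by positivity)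
  have m2 := mul_le_mul_of_nonneg_left k2 (show (0 : ℝ) ≤ 28 * (M : ℝ) ^ 2 by positivity)
  have e1 : 28 * (M : ℝ) ^ 2 * (32 / Real.exp 1) = 32 * (28 * (M : ℝ) ^ 2) / Real.exp 1 := by ring
  unfold beta0
  nlinarith

variable {Ω V P : Type*} [MeasurableSpace Ω] [Fintype V] [Fintype P] {μ : Measure Ω}
  [IsProbabilityMeasure μ] {E : P → Set Ω} {e : P → Finset V}

/-- Concentration of the quadratic form of the centred adjacency matrix, simultaneously for at most
`9 ^ n` vectors of the unit ball. -/
theorem quadForm_concentration [DecidableEq V] [Nonempty V] (hE : ∀ p, MeasurableSet (E p))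
    (hind : iIndepSet E μ) {M : ℕ} (hM : 2 ≤ M) {c β d : ℝ} (hc : 0 < c)
    (hβ : IsLargeEnough M c β) (he : ∀ p, (e p).card ≤ M) (hd : 0 < d)
    (hcd : c * Real.log (Fintype.card V) ≤ d)
    (hdeg : ∀ i, ∑ p, (if i ∈ e p then 1 else 0) * μ.real (E p) ≤ d)
    (hcodeg : ∀ i j, ∑ p, pairIndicator (e p) i j * μ.real (E p) ≤ M * d / Fintype.card V)
    {ι : Type*} (N : Finset ι) (hN : N.card ≤ 9 ^ Fintype.card V) (x : ι → V → ℝ)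
    (hx : ∀ a ∈ N, ∑ i, x a i ^ 2 ≤ 1) :
    μ.real {ω | ∃ a ∈ N, (5 * (M : ℝ) ^ 2 + beta0 M * Real.sqrt β + M) * Real.sqrt d <
      |∑ i, ∑ j, x a i * x a j *
        (randomAdjacency E e ω i j - ∑ p, pairIndicator (e p) i j * μ.real (E p))|} ≤
      2 * ((Fintype.card V : ℝ) ^ 10)⁻¹ + 2 * Real.exp (-(Fintype.card V : ℝ)) := by
  set n : ℝ := (Fintype.card V : ℝ) with hn
  have hn0 : 0 < n := by rw [hn]; exact_mod_cast Fintype.card_pos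
  set r := Real.sqrt d with hr
  have hr0 : 0 < r := Real.sqrt_pos.2 hd
  have hrd : r ^ 2 = d := Real.sq_sqrt hd.le
  have hM2 : (2 : ℝ) ≤ M := by exact_mod_cast hM
  have hM0 : (0 : ℝ) < M := by linarith
  obtain ⟨hβM, hβc⟩ := hβ
  set w := Real.sqrt β with hw
  have hw0 : 0 < w := Real.sqrt_pos.2 (by linarith)
  have hwβ : w ^ 2 = β := Real.sq_sqrt (by linarith)
  have heM : ∀ p, ((e p).card : ℝ) ≤ M := fun p => by exact_mod_cast he p
  set m : V → V → ℝ := fun i j => ∑ p, pairIndicator (e p) i j * μ.real (E p) with hm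
  set k := β / M with hk
  have hk1 : 1 ≤ k := ((one_lt_div hM0).2 hβM).le
  set D : Set Ω := {ω | ∃ i, k * d ≤ weightedCount E (fun p => if i ∈ e p then 1 else 0) ω} with hD
  have hDle : μ.real D ≤ (n ^ 10)⁻¹ := by
    refine degree_le hE hind hdeg hk1 ?_
    have hlog : 0 ≤ Real.log n := Real.log_natCast_nonneg _
    calc 11 * Real.log n = c * Real.log n * (11 / c) := by field_simp
      _ ≤ d * (k * Real.log k - k + 1) := mul_le_mul hcd hβc.le (by positivity) hd.le
  set S : Set Ω := {ω | ¬ HasDiscrepancy (randomAdjacency E e ω) (M * d) (28 * (M : ℝ) ^ 2)} with hS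
  have hSle : μ.real S ≤ (n ^ 10)⁻¹ := discrepancy_le hE hind hM0 hd heM hcodeg
  set c' : ι → V → V → ℝ := fun a i j =>
    if |x a i * x a j| ≤ r / n then x a i * x a j else 0 with hc'
  set Lt : ι → Set Ω := fun a => {ω | 5 * (M : ℝ) ^ 2 * r ≤
    |∑ i, ∑ j, c' a i j * (randomAdjacency E e ω i j - m i j)|} with hLt
  have hLtle : ∀ a ∈ N, μ.real (Lt a) ≤ 2 * Real.exp (-(9 / 2 * n)) := by
    intro a ha
    refine light_le hE hind hM2 hr0 heM (by rw [hrd]; exact hcodeg) ?_ ?_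
    · intro i j
      simp only [hc']
      split_ifs with h
      · exact h
      · rw [abs_zero]; positivity
    · calc ∑ i, ∑ j, c' a i j ^ 2 ≤ ∑ i, ∑ j, x a i ^ 2 * x a j ^ 2 := by
            refine Finset.sum_le_sum fun i _ => Finset.sum_le_sum fun j _ => ?_
            simp only [hc']
            split_ifs with h
            · rw [mul_pow]
            · rw [zero_pow two_ne_zero]; positivity
        _ = (∑ i, x a i ^ 2) * ∑ j, x a j ^ 2 := by rw [Finset.sum_mul_sum]
        _ ≤ 1 * 1 := mul_le_mul (hx a ha) (hx a ha)
            (Finset.sum_nonneg fun i _ => sq_nonneg _) zero_le_one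
        _ = 1 := one_mul 1
  have hLtsum : μ.real (⋃ a ∈ N, Lt a) ≤ 2 * Real.exp (-n) := by
    calc _ ≤ ∑ a ∈ N, μ.real (Lt a) := measureReal_biUnion_finset_le _ _
      _ ≤ ∑ _a ∈ N, 2 * Real.exp (-(9 / 2 * n)) := Finset.sum_le_sum hLtle
      _ = N.card * (2 * Real.exp (-(9 / 2 * n))) := by rw [Finset.sum_const, nsmul_eq_mul]
      _ ≤ Real.exp (n * (7 / 2)) * (2 * Real.exp (-(9 / 2 * n))) := by
          gcongr
          have h9 : (9 : ℝ) ≤ Real.exp (7 / 2) := by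
            have h3 : Real.exp 3 = Real.exp 1 * Real.exp 1 * Real.exp 1 := by
              rw [← Real.exp_add, ← Real.exp_add]; norm_num
            have h1 := Real.exp_one_gt_d9
            have h4 : Real.exp 3 ≤ Real.exp (7 / 2) := Real.exp_le_exp.2 (by norm_num)
            have h5 : 4 ≤ Real.exp 1 * Real.exp 1 := by nlinarith
            nlinarith
          calc (N.card : ℝ) ≤ 9 ^ Fintype.card V := by exact_mod_cast hN
            _ ≤ Real.exp (7 / 2) ^ Fintype.card V := by gcongr
            _ = _ := by rw [← Real.exp_nat_mul]
      _ = 2 * Real.exp (-n) := by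
          rw [mul_left_comm, ← Real.exp_add]; ring_nf
  have hsub : {ω | ∃ a ∈ N, (5 * (M : ℝ) ^ 2 + beta0 M * w + M) * r <
      |∑ i, ∑ j, x a i * x a j * (randomAdjacency E e ω i j - m i j)|} ⊆
      (D ∪ S) ∪ ⋃ a ∈ N, Lt a := by
    rintro ω ⟨a, ha, hω⟩
    by_contra hcon
    simp only [Set.mem_union, not_or] at hcon
    obtain ⟨⟨hωD, hωS⟩, hωL⟩ := hcon
    have hA : ∀ i j, 0 ≤ randomAdjacency E e ω i j := fun i j =>
      weightedCount_nonneg E (fun p => pairIndicator_nonneg _ _ _) ω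
    have hdisc : HasDiscrepancy (randomAdjacency E e ω) (M * r ^ 2) (28 * (M : ℝ) ^ 2) := by
      rw [hrd]; exact not_not.1 hωS
    have hrow : ∀ i, ∑ j, randomAdjacency E e ω i j ≤ w ^ 2 * r ^ 2 := by
      intro i
      have hdegi : weightedCount E (fun p => if i ∈ e p then 1 else 0) ω ≤ k * d := by
        by_contra! h
        exact hωD ⟨i, h.le⟩
      calc ∑ j, randomAdjacency E e ω i j
          = weightedCount E (fun p => ∑ j, pairIndicator (e p) i j) ω :=
            sum_weightedCount E _ _ ω
        _ ≤ weightedCount E (fun p => (M : ℝ) * (if i ∈ e p then 1 else 0)) ω :=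
            weightedCount_mono E (fun p => (sum_pairIndicator_right_le _ _).trans
              (mul_le_mul_of_nonneg_right (heM p) (by split_ifs <;> norm_num))) ω
        _ = M * weightedCount E (fun p => if i ∈ e p then 1 else 0) ω := weightedCount_smul _ _ ω
        _ ≤ M * (k * d) := by gcongr
        _ = w ^ 2 * r ^ 2 := by rw [hwβ, hrd, hk]; field_simp
    have hheavy := heavy_sum_le hA
      (fun i j => by simp only [randomAdjacency, pairIndicator_symm _ i j]) hr0 hw0 hM0
      (by positivity) hrow hdisc (hx a ha)
    have hlight : |∑ i, ∑ j, c' a i j * (randomAdjacency E e ω i j - m i j)| ≤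
        5 * (M : ℝ) ^ 2 * r := by
      by_contra! h
      exact hωL (Set.mem_biUnion ha h.le)
    have hmnn : ∀ i j, 0 ≤ m i j := fun i j => Finset.sum_nonneg fun p _ =>
      mul_nonneg (pairIndicator_nonneg _ _ _) measureReal_nonneg
    have hq := quadForm_le hr0 hA hmnn hM0.le (by rw [hrd]; exact hcodeg) (hx a ha) hlight hheavy
    have hconst := heavy_const_le M hM (Real.sqrt_le_sqrt (by linarith : (2 : ℝ) ≤ β))
    have := mul_le_mul_of_nonneg_right hconst hr0.le
    nlinarith
  calc _ ≤ μ.real ((D ∪ S) ∪ ⋃ a ∈ N, Lt a) := measureReal_mono hsub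
    _ ≤ μ.real (D ∪ S) + μ.real (⋃ a ∈ N, Lt a) := measureReal_union_le _ _
    _ ≤ (μ.real D + μ.real S) + μ.real (⋃ a ∈ N, Lt a) := by
        gcongr
        exact measureReal_union_le _ _
    _ ≤ _ := by linarith

end Concentration

/-! ### The Erdős–Rényi hypergraph as a family of independent hyperedges -/

section Reduction

theorem card_powersetCard_filter_superset_le {V : Type*} [Fintype V] [DecidableEq V] (s : Finset V)
    (m : ℕ) : (((Finset.univ : Finset V).powersetCard m).filter fun e => s ⊆ e).card ≤
      (Fintype.card V - s.card).choose (m - s.card) := by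
  rw [← Finset.card_compl, ← Finset.card_powersetCard]
  refine Finset.card_le_card_of_injOn (fun e => e \ s) ?_ ?_
  · intro e he
    obtain ⟨he1, hs⟩ := Finset.mem_filter.1 (Finset.mem_coe.1 he)
    refine Finset.mem_coe.2 (Finset.mem_powersetCard.2 ⟨?_, ?_⟩)
    · intro v hv
      exact Finset.mem_compl.2 (Finset.mem_sdiff.1 hv).2
    · rw [Finset.card_sdiff_of_subset hs, (Finset.mem_powersetCard.1 he1).2]
  · intro e he e' he' h
    have hs := (Finset.mem_filter.1 (Finset.mem_coe.1 he)).2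
    have hs' := (Finset.mem_filter.1 (Finset.mem_coe.1 he')).2
    rw [← Finset.sdiff_union_of_subset hs, ← Finset.sdiff_union_of_subset hs']
    exact congrArg (· ∪ s) h

/-- Two vertices lie in at most a fraction `m / n` of the `m`-sets containing a given vertex. -/
theorem card_mul_choose_le {n m : ℕ} (hn : 2 ≤ n) (hm : 2 ≤ m) :
    n * (n - 2).choose (m - 2) ≤ m * (n - 1).choose (m - 1) := by
  obtain ⟨n, rfl⟩ := Nat.exists_eq_add_of_le hn
  obtain ⟨m, rfl⟩ := Nat.exists_eq_add_of_le hm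
  have h1 := Nat.add_one_mul_choose_eq n m
  have h2 : n.choose m ≤ (n + 1).choose (m + 1) := by
    rw [Nat.choose_succ_succ]; exact Nat.le_add_right _ _
  rw [show 2 + n - 2 = n by omega, show 2 + m - 2 = m by omega, show 2 + n - 1 = n + 1 by omega,
    show 2 + m - 1 = m + 1 by omega]
  nlinarith

/-- The possible hyperedges: pairs of a size `m ∈ 𝓜` and an `m`-subset of `[n]`. -/
abbrev PossibleEdge (n : ℕ) (𝓜 : Finset ℕ) : Type :=
  (m : {m : ℕ // m ∈ 𝓜}) × {e : Finset (Fin n) // e.card = m.1}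

theorem sum_possibleEdge {n : ℕ} {𝓜 : Finset ℕ} (f : ℕ → Finset (Fin n) → ℝ) :
    ∑ p : PossibleEdge n 𝓜, f p.1.1 p.2.1 =
      ∑ m ∈ 𝓜, ∑ e ∈ (Finset.univ : Finset (Fin n)).powersetCard m, f m e := by
  rw [Fintype.sum_sigma, ← Finset.sum_coe_sort 𝓜]
  refine Finset.sum_congr rfl fun m _ => ?_
  exact (Finset.sum_subtype _ (fun e => by simp [Finset.mem_powersetCard]) fun e => f m.1 e).symm

/-- The event that a possible hyperedge is present. -/
def edgeEvent {n : ℕ} {Ω : Type*} {𝓜 : Finset ℕ} (H : (m : ℕ) → Ω → UniformHypergraph (Fin n) m)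
    (p : PossibleEdge n 𝓜) : Set Ω :=
  {ω | (p.2.1 : Set (Fin n)) ∈ (H p.1.1 ω).edgeSet}

theorem adjacencyMatrix_eq {n : ℕ} {Ω : Type*} (𝓜 : Finset ℕ)
    (H : (m : ℕ) → Ω → UniformHypergraph (Fin n) m) (ω : Ω) (i j : Fin n) :
    adjacencyMatrix 𝓜 (fun m => H m ω) i j =
      randomAdjacency (edgeEvent (𝓜 := 𝓜) H) (fun p => p.2.1) ω i j := by
  classical
  have h : randomAdjacency (edgeEvent (𝓜 := 𝓜) H) (fun p => p.2.1) ω i j =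
      ∑ m ∈ 𝓜, ∑ e ∈ (Finset.univ : Finset (Fin n)).powersetCard m,
        pairIndicator e i j * (H m ω).edgeIndicator e := by
    rw [← sum_possibleEdge fun m e => pairIndicator e i j * (H m ω).edgeIndicator e]
    simp only [randomAdjacency, weightedCount, edgeEvent, UniformHypergraph.edgeIndicator,
      Set.indicator_apply, Set.mem_ofPred_eq, Pi.one_apply]
  rw [h]
  simp only [adjacencyMatrix, Matrix.of_apply]
  split_ifs with hij
  · refine Finset.sum_congr rfl fun m _ => ?_
    rw [Finset.sum_filter]
    refine Finset.sum_congr rfl fun e _ => ?_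
    simp only [pairIndicator, Finset.insert_subset_iff, Finset.singleton_subset_iff, ne_eq, hij,
      not_false_eq_true, true_and, ite_mul, one_mul, zero_mul]
  · refine (Finset.sum_eq_zero fun m _ => Finset.sum_eq_zero fun e _ => ?_).symm
    rw [pairIndicator, if_neg fun h => hij h.1, zero_mul]

variable {n : ℕ} {Ω : Type*} [MeasurableSpace Ω] {μ : Measure Ω}
  {𝓜 : Finset ℕ} {Q : (m : ℕ) → Tensor n m} {H : (m : ℕ) → Ω → UniformHypergraph (Fin n) m}

theorem IsErdosRenyi.choose_mul_prob_le (h : IsErdosRenyi μ 𝓜 Q H) {m : ℕ} (hm : m ∈ 𝓜)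
    {e : Finset (Fin n)} (he : e.card = m) :
    ((n - 1).choose (m - 1) : ℝ) * μ.real {ω | (e : Set (Fin n)) ∈ (H m ω).edgeSet} ≤
      ⨆ i, degreeTensor (Q m) i := by
  set i : Fin m → Fin n := ⇑(e.orderEmbOfFin he) with hi
  have himg : Finset.univ.image i = e := Finset.image_orderEmbOfFin_univ e he
  have hp := h.prob_eq m hm i (e.orderEmbOfFin he).injective
  have hset : {ω | (H m ω).adjacencyTensor i = 1} =
      {ω | (e : Set (Fin n)) ∈ (H m ω).edgeSet} := by
    ext ω
    simp [UniformHypergraph.adjacencyTensor, UniformHypergraph.edgeIndicator, himg]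
  rw [hset] at hp
  rw [hp]
  exact le_ciSup (f := fun i => degreeTensor (Q m) i) (Set.finite_range _).bddAbove i

theorem IsErdosRenyi.iSup_degreeTensor_nonneg (h : IsErdosRenyi μ 𝓜 Q H) {m : ℕ} (hm : m ∈ 𝓜) :
    0 ≤ ⨆ i, degreeTensor (Q m) i :=
  Real.iSup_nonneg fun i => mul_nonneg (Nat.cast_nonneg _) (h.mem_Icc m hm i).1

/-- The expected number of hyperedges of size `m` in a family `G` of `m`-sets which is a fraction
`θ` of the `choose (n - 1) (m - 1)` sets containing a given vertex. -/
theorem IsErdosRenyi.sum_prob_le (h : IsErdosRenyi μ 𝓜 Q H) {m : ℕ} (hm : m ∈ 𝓜)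
    {G : Finset (Finset (Fin n))} (hG : ∀ e ∈ G, e.card = m) {θ : ℝ}
    (hθ : (G.card : ℝ) ≤ θ * (n - 1).choose (m - 1)) (hθ0 : 0 ≤ θ) :
    ∑ e ∈ G, μ.real {ω | (e : Set (Fin n)) ∈ (H m ω).edgeSet} ≤
      θ * ⨆ i, degreeTensor (Q m) i := by
  have hD := h.iSup_degreeTensor_nonneg hm
  rcases Nat.eq_zero_or_pos ((n - 1).choose (m - 1)) with h0 | hpos
  · rw [h0, Nat.cast_zero, mul_zero] at hθ
    have : G = ∅ := Finset.card_eq_zero.1 (by exact_mod_cast le_antisymm hθ (Nat.cast_nonneg _))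
    rw [this, Finset.sum_empty]
    positivity
  · have hC : (0 : ℝ) < (n - 1).choose (m - 1) := by exact_mod_cast hpos
    calc _ ≤ ∑ _e ∈ G, (⨆ i, degreeTensor (Q m) i) / (n - 1).choose (m - 1) := by
          refine Finset.sum_le_sum fun e he => ?_
          rw [le_div_iff₀ hC, mul_comm]
          exact h.choose_mul_prob_le hm (hG e he)
      _ = G.card * ((⨆ i, degreeTensor (Q m) i) / (n - 1).choose (m - 1)) := by
          rw [Finset.sum_const, nsmul_eq_mul]
      _ ≤ θ * (n - 1).choose (m - 1) *
          ((⨆ i, degreeTensor (Q m) i) / (n - 1).choose (m - 1)) := by gcongr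
      _ = _ := by field_simp

theorem IsErdosRenyi.expected_degree_le (h : IsErdosRenyi μ 𝓜 Q H) (v : Fin n) :
    ∑ p : PossibleEdge n 𝓜, (if v ∈ p.2.1 then 1 else 0) * μ.real (edgeEvent H p) ≤ dMax 𝓜 Q := by
  have e1 := sum_possibleEdge (n := n) (𝓜 := 𝓜) fun m e =>
    (if v ∈ e then 1 else 0) * μ.real {ω | (e : Set (Fin n)) ∈ (H m ω).edgeSet}
  refine e1.trans_le (Finset.sum_le_sum fun m hm => ?_)
  simp only [ite_mul, one_mul, zero_mul]
  rw [← Finset.sum_filter]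
  refine (h.sum_prob_le hm (fun e he => ?_) ?_ zero_le_one).trans_eq (one_mul _)
  · exact (Finset.mem_powersetCard.1 (Finset.mem_filter.1 he).1).2
  · have := card_powersetCard_filter_superset_le ({v} : Finset (Fin n)) m
    simp only [Finset.singleton_subset_iff, Finset.card_singleton, Fintype.card_fin] at this
    rw [one_mul]
    exact_mod_cast this

theorem IsErdosRenyi.expected_codegree_le (h : IsErdosRenyi μ 𝓜 Q H) (h𝓜 : ∀ m ∈ 𝓜, 2 ≤ m)
    {M : ℕ} (hM : ∀ m ∈ 𝓜, m ≤ M) (hn : 2 ≤ n) (i j : Fin n) :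
    ∑ p : PossibleEdge n 𝓜, pairIndicator p.2.1 i j * μ.real (edgeEvent H p) ≤
      M * dMax 𝓜 Q / n := by
  classical
  have hn0 : (0 : ℝ) < n := by exact_mod_cast (by omega : 0 < n)
  have e1 := sum_possibleEdge (n := n) (𝓜 := 𝓜) fun m e =>
    pairIndicator e i j * μ.real {ω | (e : Set (Fin n)) ∈ (H m ω).edgeSet}
  refine e1.trans_le ?_
  rw [dMax, mul_div_right_comm, Finset.mul_sum]
  refine Finset.sum_le_sum fun m hm => ?_
  have hD := h.iSup_degreeTensor_nonneg hm
  by_cases hij : i = j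
  · refine (Finset.sum_eq_zero fun e _ => ?_).trans_le (by positivity)
    rw [pairIndicator, if_neg fun h' => h'.1 hij, zero_mul]
  have hterm : ∀ e : Finset (Fin n), pairIndicator e i j = if {i, j} ⊆ e then 1 else 0 := by
    intro e
    simp only [pairIndicator, Finset.insert_subset_iff, Finset.singleton_subset_iff, ne_eq, hij,
      not_false_eq_true, true_and]
  simp only [hterm, ite_mul, one_mul, zero_mul]
  rw [← Finset.sum_filter]
  refine h.sum_prob_le hm (fun e he => ?_) ?_ (by positivity)
  · exact (Finset.mem_powersetCard.1 (Finset.mem_filter.1 he).1).2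
  · have h1 := card_powersetCard_filter_superset_le ({i, j} : Finset (Fin n)) m
    rw [Finset.card_pair hij, Fintype.card_fin] at h1
    rw [div_mul_eq_mul_div, le_div_iff₀ hn0]
    have h2 : (((Finset.univ : Finset (Fin n)).powersetCard m).filter fun e => {i, j} ⊆ e).card * n
        ≤ M * (n - 1).choose (m - 1) := by
      calc _ ≤ (n - 2).choose (m - 2) * n := Nat.mul_le_mul_right _ h1
        _ = n * (n - 2).choose (m - 2) := mul_comm _ _
        _ ≤ m * (n - 1).choose (m - 1) := card_mul_choose_le hn (h𝓜 m hm)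
        _ ≤ _ := Nat.mul_le_mul_right _ (hM m hm)
    exact_mod_cast h2

theorem inner_toEuclideanCLM_self (W : Matrix (Fin n) (Fin n) ℝ) (x : EuclideanSpace ℝ (Fin n)) :
    inner ℝ (Matrix.toEuclideanCLM (n := Fin n) (𝕜 := ℝ) W x) x =
      ∑ i, ∑ j, x i * x j * W i j := by
  rw [PiLp.inner_apply]
  refine Finset.sum_congr rfl fun i _ => ?_
  rw [Matrix.ofLp_toEuclideanCLM]
  simp only [Matrix.mulVec, dotProduct, RCLike.inner_apply, conj_trivial, Finset.mul_sum]
  exact Finset.sum_congr rfl fun j _ => by ring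

theorem isSymmetric_toEuclideanCLM {W : Matrix (Fin n) (Fin n) ℝ} (hW : ∀ i j, W i j = W j i) :
    (Matrix.toEuclideanCLM (n := Fin n) (𝕜 := ℝ) W :
      EuclideanSpace ℝ (Fin n) →ₗ[ℝ] EuclideanSpace ℝ (Fin n)).IsSymmetric := by
  intro x y
  simp only [ContinuousLinearMap.coe_coe, PiLp.inner_apply, Matrix.ofLp_toEuclideanCLM,
    Matrix.mulVec, dotProduct, RCLike.inner_apply, conj_trivial, Finset.mul_sum, Finset.sum_mul]
  rw [Finset.sum_comm]
  refine Finset.sum_congr rfl fun i _ => Finset.sum_congr rfl fun j _ => ?_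
  rw [hW]; ring

theorem exists_isLargeEnough {M : ℕ} (hM : 0 < M) {c : ℝ} (hc : 0 < c) :
    ∃ β : ℝ, IsLargeEnough M c β := by
  have hM' : (0 : ℝ) < M := by exact_mod_cast hM
  have hc' : 0 < 11 / c := by positivity
  set k := Real.exp (2 + 11 / c) with hk
  have hk1 : 1 < k := by rw [hk]; exact Real.one_lt_exp_iff.2 (by linarith)
  -- `k * log k - k + 1 = k * (1 + 11 / c) + 1`
  refine ⟨M * k, by nlinarith, ?_⟩
  rw [mul_div_cancel_left₀ _ hM'.ne', hk, Real.log_exp, ← hk]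
  nlinarith

end Reduction

end RandomHypergraph

theorem theorem2 (𝓜 : Finset ℕ) (h𝓜 : ∀ m ∈ 𝓜, 2 ≤ m)
    (M : ℕ) (hM : IsGreatest (𝓜 : Set ℕ) M) (c : ℝ) (hc : 0 < c) :
    (∃ β₁ : ℝ, RandomHypergraph.IsLargeEnough M c β₁) ∧
    ∀ β₁ : ℝ, RandomHypergraph.IsLargeEnough M c β₁ →
    ∀ (n : ℕ), 0 < n →
    ∀ (Ω : Type*) [MeasurableSpace Ω] (μ : Measure Ω) [IsProbabilityMeasure μ]
      (Q : (m : ℕ) → RandomHypergraph.Tensor n m)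
      (H : (m : ℕ) → Ω → RandomHypergraph.UniformHypergraph (Fin n) m),
      RandomHypergraph.IsErdosRenyi μ 𝓜 Q H →
      c * Real.log n ≤ RandomHypergraph.dMax 𝓜 Q →
      1 - 2 * (n : ℝ) ^ (-10 : ℤ) - 2 * Real.exp (-(n : ℝ)) ≤
        μ.real {ω |
          RandomHypergraph.opNorm
              (RandomHypergraph.adjacencyMatrix 𝓜 (fun m => H m ω) -
                RandomHypergraph.expectedMatrix μ
                  (fun ω' => RandomHypergraph.adjacencyMatrix 𝓜 (fun m => H m ω'))) ≤
            RandomHypergraph.concentrationConst M β₁ *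
              Real.sqrt (RandomHypergraph.dMax 𝓜 Q)} := by
  have hM2 : 2 ≤ M := h𝓜 M hM.1
  refine ⟨RandomHypergraph.exists_isLargeEnough (by omega) hc, ?_⟩
  intro β₁ hβ n hn Ω _ μ _ Q H hER hd
  rcases (show n = 1 ∨ 2 ≤ n by omega) with rfl | hn2
  · -- for a single vertex the claimed lower bound for the probability is negative
    refine le_trans ?_ measureReal_nonneg
    have := Real.exp_pos (-1)
    norm_num
    linarith
  have : Nonempty (Fin n) := ⟨⟨0, hn⟩⟩
  set d := RandomHypergraph.dMax 𝓜 Q with hdef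
  have hdpos : 0 < d := by
    refine lt_of_lt_of_le (mul_pos hc (Real.log_pos ?_)) hd
    exact_mod_cast (by omega : 1 < n)
  have hE : ∀ p : RandomHypergraph.PossibleEdge n 𝓜,
      MeasurableSet (RandomHypergraph.edgeEvent H p) := fun p =>
    hER.measurableSet p.1.1 p.1.2 p.2.1
  have hexp : ∀ i j, RandomHypergraph.expectedMatrix μ
      (fun ω' => RandomHypergraph.adjacencyMatrix 𝓜 (fun m => H m ω')) i j =
      ∑ p : RandomHypergraph.PossibleEdge n 𝓜,
        RandomHypergraph.pairIndicator p.2.1 i j * μ.real (RandomHypergraph.edgeEvent H p) := by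
    intro i j
    simp only [RandomHypergraph.expectedMatrix, Matrix.of_apply,
      RandomHypergraph.adjacencyMatrix_eq, RandomHypergraph.randomAdjacency]
    exact RandomHypergraph.integral_weightedCount hE _
  obtain ⟨N, hN1, hNnet, hNcard⟩ :=
    RandomHypergraph.exists_quarter_net (EuclideanSpace ℝ (Fin n))
  rw [finrank_euclideanSpace] at hNcard
  have hconc := RandomHypergraph.quadForm_concentration (e := fun p => p.2.1) hE hER.indep hM2 hc hβ
    (fun p => p.2.2.trans_le (hM.2 p.1.2)) hdpos (by rw [Fintype.card_fin]; exact hd)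
    hER.expected_degree_le
    (by rw [Fintype.card_fin]; exact hER.expected_codegree_le h𝓜 (fun m hm => hM.2 hm) hn2)
    N hNcard (fun a i => a i) (fun a ha => by
      have h1 := hN1 a ha
      have h2 := EuclideanSpace.real_norm_sq_eq a
      rw [← h2]
      exact pow_le_one₀ (norm_nonneg _) h1)
  rw [Fintype.card_fin] at hconc
  set good := {ω | RandomHypergraph.opNorm
      (RandomHypergraph.adjacencyMatrix 𝓜 (fun m => H m ω) -
        RandomHypergraph.expectedMatrix μ
          (fun ω' => RandomHypergraph.adjacencyMatrix 𝓜 (fun m => H m ω'))) ≤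
      RandomHypergraph.concentrationConst M β₁ * Real.sqrt d} with hgood
  have hcompl := (measureReal_mono (μ := μ) (s₁ := goodᶜ) fun ω hω => ?_).trans hconc
  · have huniv : (1 : ℝ) ≤ μ.real good + μ.real goodᶜ := by
      rw [← probReal_univ (μ := μ), ← Set.union_compl_self good]
      exact measureReal_union_le _ _
    have hpow : (n : ℝ) ^ (-10 : ℤ) = ((n : ℝ) ^ 10)⁻¹ := by
      rw [zpow_neg]; norm_cast
    rw [hpow]
    linarith
  · by_contra hcon
    refine hω ?_
    have hcon' : ∀ a ∈ N, _ := fun a ha => not_lt.1 fun h => hcon ⟨a, ha, h⟩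
    obtain ⟨W, hWdef⟩ : ∃ W, W = RandomHypergraph.adjacencyMatrix 𝓜 (fun m => H m ω) -
        RandomHypergraph.expectedMatrix μ
          (fun ω' => RandomHypergraph.adjacencyMatrix 𝓜 (fun m => H m ω')) := ⟨_, rfl⟩
    have hW : ∀ i j, W i j =
        RandomHypergraph.randomAdjacency (RandomHypergraph.edgeEvent (𝓜 := 𝓜) H)
          (fun p => p.2.1) ω i j - ∑ p : RandomHypergraph.PossibleEdge n 𝓜,
        RandomHypergraph.pairIndicator p.2.1 i j * μ.real (RandomHypergraph.edgeEvent H p) := by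
      intro i j
      rw [hWdef, Matrix.sub_apply, hexp, RandomHypergraph.adjacencyMatrix_eq]
    have hsymm : ∀ i j, W i j = W j i := by
      intro i j
      rw [hW, hW]
      simp only [RandomHypergraph.randomAdjacency, RandomHypergraph.pairIndicator_symm _ i j]
    have hnorm := RandomHypergraph.norm_le_two_mul_of_net
      (RandomHypergraph.isSymmetric_toEuclideanCLM hsymm) hN1 hNnet fun a ha => by
        rw [RandomHypergraph.inner_toEuclideanCLM_self]
        simp only [hW]
        exact hcon' a ha
    rw [hgood, Set.mem_ofPred_eq, ← hWdef]
    refine hnorm.trans_eq ?_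
    rw [RandomHypergraph.concentrationConst]
    ring
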